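/- **Conventions.** A *pseudogroup* on a topological space $Z$ is a set $\mathcal H$ of homeomorphisms between open subsets of $Z$ that contains $\mathrm{id}_Z$ and is closed under composition (wherever defined), inversion, restriction to open sets and combination (union) of maps; the pseudogroup *generated* by a set $E$ of such homeomorphisms is the smallest one containing $E$. The *orbit* of $x$ is $\{h(x) : h\in\mathcal H,\ x\in\operatorname{dom}h\}$. A set of maps is *symmetric* if it contains the inverses of its elements. * $\mathcal H$ is *compactly generated* if there is a relatively compact open set $U\subset Z$ meeting every orbit such that the restriction of $\mathcal H$ to $U$ (the pseudogroup on $U$ of all $h\in\mathcal H$ with domain and image contained in $U$) is generated by a finite symmetric set $E$, each $g\in E$ being the restriction of some $\bar g\in\mathcal H$ defined on a neighborhood of the closure in $Z$ of $\operatorname{dom}g$. * $\mathcal H$ is *quasi-effective* if it is generated by a symmetric set $S$, closed under compositions, such that any $h\in S$ that is the identity on some non-empty open subset of its domain is the identity on its whole domain. * A *cover of $Z$ by quasi-locally equal metric spaces inducing the topology* is a family $\{(Z_i,d_i)\}_{i\in I}$ of metric spaces, with the $Z_i$ open in $Z$ and covering $Z$ and $d_i$ inducing the subspace topology on $Z_i$,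 for which there is an assignment $\varepsilon\mapsto\delta(\varepsilon)>0$ such that every $z\in Z_i\cap Z_j$ has an open neighborhood $V\subset Z_i\cap Z_j$ satisfying $d_i(x,y)<\delta(\varepsilon)\Rightarrow d_j(x,y)<\varepsilon$ for all $\varepsilon>0$ and $x,y\in V$ (for all $i,j\in I$). * $\mathcal H$ is *strongly equicontinuous* if there are such a cover $\{(Z_i,d_i)\}_{i\in I}$ and a symmetric set $S$ of generators of $\mathcal H$, closed under compositions, such that for every $\varepsilon>0$ there is $\delta>0$ with $d_i(x,y)<\delta\Rightarrow d_j(h(x),h(y))<\varepsilon$ for all $h\in S$, $i,j\in I$ and $x,y\in Z_i\cap\operatorname{dom}h$ with $h(x),h(y)\in Z_j$. * A space is *homogeneous* if the pseudogroup of all homeomorphisms between its open subsets has exactly one orbit. A *foliated space* of leaf dimension $n$ is a locally compact Polish space $X$ with a foliated atlas: charts (flow boxes) $\phi_i:U_i\to B_i\times T_i$ that are homeomorphisms, where the open sets $U_i$ cover $X$, the $B_i\subset\mathbb R^n$ are open balls of finite radius and the $T_i$ are Polish spaces, such that, with $p_i:U_i\to T_i$ the second component of $\phi_i$, near each point of $U_i\cap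 U_j$ the map $p_j$ is a continuous function of $p_i$. Two atlases define the same foliated structure if all coordinate changes between them, in both directions, have this property too. The *plaques* are the fibers of the $p_i$; the *leaves* are the connected components of $X$ for the topology whose basic open sets are the open subsets of the plaques. The *holonomy pseudogroup* of an atlas is the pseudogroup on $\bigsqcup_iT_i$ generated by the homeomorphisms $h:p_i(W)\to p_j(W)$ with $p_j=h\circ p_i$ on $W$, where $W\subset U_i\cap U_j$ is open. A foliated space is *strongly equicontinuous*, respectively *quasi-effective*, if the holonomy pseudogroup of some atlas of its foliated structure is so. **Statement.** (1) Let $\mathcal H$ be a quasi-effective, compactly generated and strongly equicontinuous pseudogroup on a locally compact Polish space $Z$. Then the closure in $Z$ of every orbit of $\mathcal H$, with the subspace topology, is a homogeneous space. (2) Let $X$ be a compact, strongly equicontinuous and quasi-effective foliated space. Then the closure in $X$ of every leaf, with the subspace topology, is a homogeneous space. -/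

import Mathlib

open Set TopologicalSpace

universe u v

namespace LocalTransformations

/-! Pseudogroups of local transformations. A pseudogroup on a space `Z` is a `StructureGroupoid Z`
which is closed under restriction to open sets; the field `locality'` of a structure groupoid is
closure under combination of maps. -/

section Pseudogroups

variable {Z : Type u} [TopologicalSpace Z]

/-- The pseudogroup generated by a set of homeomorphisms between open subsets of `Z`: the smallest
pseudogroup that contains it. -/
def generatedPseudogroup (E : Set (OpenPartialHomeomorph Z Z)) : StructureGroupoid Z :=
  sInf {G | ClosedUnderRestriction G ∧ ∀ e ∈ E, e ∈ G}

instance (E : Set (OpenPartialHomeomorph Z Z)) :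
    ClosedUnderRestriction (generatedPseudogroup E) := by
  constructor
  intro e he s hs
  refine mem_iInter₂.2 fun G hG => ?_
  have := hG.1
  exact closedUnderRestriction' (mem_iInter₂.1 he G hG) hs

/-- The orbit of a point: all values `h x` of members `h` whose domain contains `x`. -/
def orbit (H : StructureGroupoid Z) (x : Z) : Set Z :=
  {y | ∃ h ∈ H, x ∈ h.source ∧ h x = y}

/-- A set of local transformations is symmetric if it contains the inverses of its elements. -/
def IsSymmetric (S : Set (OpenPartialHomeomorph Z Z)) : Prop :=
  ∀ e ∈ S, e.symm ∈ S

/-- A set of local transformations is closed under compositions (each composite being defined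
on its maximal domain). -/
def IsClosedUnderComposition (S : Set (OpenPartialHomeomorph Z Z)) : Prop :=
  ∀ e ∈ S, ∀ e' ∈ S, e.trans e' ∈ S

/-- The restriction of a pseudogroup on `Z` to an open subset `U`: the pseudogroup on `U` of all
those homeomorphisms between open subsets of `U` that belong to `H` as local transformations
of `Z`. -/
def restrictToOpen (H : StructureGroupoid Z) [ClosedUnderRestriction H] (U : Opens Z) : StructureGroupoid U where
  members := {e | ∃ h ∈ H, h.source = Subtype.val '' e.source ∧ ∀ x ∈ e.source, h x = e x}
  trans' := by
    rintro e e' ⟨h, hH, hs, he⟩ ⟨h', hH', hs', he'⟩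
    refine ⟨h.trans h', H.trans hH hH', ?_, ?_⟩
    · ext z
      simp only [OpenPartialHomeomorph.trans_source, mem_inter_iff, mem_preimage, mem_image, hs,
        hs']
      constructor
      · rintro ⟨⟨x, hx, rfl⟩, ⟨y, hy, hxy⟩⟩
        refine ⟨x, ⟨hx, ?_⟩, rfl⟩
        rw [he x hx] at hxy
        rwa [← Subtype.ext hxy]
      · rintro ⟨x, ⟨hx, hy⟩, rfl⟩
        exact ⟨⟨x, hx, rfl⟩, ⟨e x, hy, (he x hx).symm⟩⟩
    · intro x hx
      rw [OpenPartialHomeomorph.trans_source] at hx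
      simp only [OpenPartialHomeomorph.coe_trans, Function.comp_apply]
      rw [he x hx.1, he' _ hx.2]
  symm' := by
    rintro e ⟨h, hH, hs, he⟩
    have ht : h.target = Subtype.val '' e.target := by
      rw [← h.image_source_eq_target, ← e.image_source_eq_target, hs, image_image, image_image]
      exact image_congr fun x hx => he x hx
    refine ⟨h.symm, H.symm hH, ht, ?_⟩
    intro y hy
    have hx : e.symm y ∈ e.source := e.map_target hy
    have h1 : h (e.symm y) = y := by rw [he _ hx, e.right_inv hy]
    have h2 : ((e.symm y : U) : Z) ∈ h.source := by rw [hs]; exact ⟨_, hx, rfl⟩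
    rw [← h1, h.left_inv h2]
  id_mem' := by
    refine ⟨(OpenPartialHomeomorph.refl Z).restr U, closedUnderRestriction' H.id_mem U.isOpen,
      ?_, fun x _ => rfl⟩
    rw [OpenPartialHomeomorph.restr_source, U.isOpen.interior_eq]
    simp
  locality' := by
    intro e hloc
    rcases isEmpty_or_nonempty U with hU | hU
    · have he : e.source = ∅ := Set.eq_empty_of_isEmpty _
      refine ⟨(OpenPartialHomeomorph.refl Z).restr ∅,
        closedUnderRestriction' H.id_mem isOpen_empty, ?_, ?_⟩
      · simp [he]
      · intro x
        exact (IsEmpty.false x).elim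
    · let c := U.openPartialHomeomorphSubtypeCoe hU
      have hc : ∀ x : U, c.symm (x : Z) = x := fun x => c.left_inv (mem_univ x)
      let k : OpenPartialHomeomorph Z Z := (c.symm.trans e).trans c
      have hks : k.source = Subtype.val '' e.source := by
        ext z
        constructor
        · rintro ⟨⟨hz, hz'⟩, -⟩
          have hz1 : z ∈ (U : Set Z) := by
            have : z ∈ c.target := hz
            rwa [Opens.openPartialHomeomorphSubtypeCoe_target] at this
          have hz2 : c.symm z ∈ e.source := hz'
          rw [show z = ((⟨z, hz1⟩ : U) : Z) from rfl, hc] at hz2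
          exact ⟨⟨z, hz1⟩, hz2, rfl⟩
        · rintro ⟨x, hx, rfl⟩
          refine ⟨⟨?_, ?_⟩, mem_univ _⟩
          · show (x : Z) ∈ c.target
            rw [Opens.openPartialHomeomorphSubtypeCoe_target]
            exact x.2
          · show c.symm (x : Z) ∈ e.source
            rwa [hc]
      have hk : ∀ x : U, k x = e x := by
        intro x
        show ((e (c.symm (x : Z)) : U) : Z) = e x
        rw [hc]
      refine ⟨k, ?_, hks, fun x _ => hk x⟩
      apply H.locality
      intro z hz
      rw [hks] at hz
      obtain ⟨x, hx, rfl⟩ := hz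
      obtain ⟨s, hs, hxs, h, hH, hhs, hhe⟩ := hloc x hx
      have hsrc : (e.restr s).source = e.source ∩ s := by
        rw [OpenPartialHomeomorph.restr_source, hs.interior_eq]
      have hso : IsOpen (Subtype.val '' s : Set Z) := U.isOpen.isOpenMap_subtype_val s hs
      have hint : interior (Subtype.val '' s : Set Z) = Subtype.val '' s := hso.interior_eq
      refine ⟨Subtype.val '' s, hso, ⟨x, hxs, rfl⟩, ?_⟩
      refine H.mem_of_eqOnSource hH ⟨?_, ?_⟩
      · show (k.restr _).source = h.source
        rw [OpenPartialHomeomorph.restr_source,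
          hint, hks, hhs, hsrc,
          image_inter Subtype.val_injective]
      · intro z hz
        have hz' : z ∈ (k.restr (Subtype.val '' s)).source := hz
        rw [OpenPartialHomeomorph.restr_source,
          hint, hks,
          ← image_inter Subtype.val_injective] at hz'
        obtain ⟨y, hy, rfl⟩ := hz'
        have h1 := hhe y (by rw [hsrc]; exact hy)
        show k (y : Z) = h y
        rw [hk, h1]
        rfl
  mem_of_eqOnSource' := by
    rintro e e' ⟨h, hH, hs, he⟩ hee'
    refine ⟨h, hH, by rw [hs, hee'.1], ?_⟩
    intro x hx
    rw [hee'.2 hx]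
    exact he x (hee'.1 ▸ hx)

/-- A pseudogroup on a locally compact space is compactly generated if some relatively compact open
set `U` meets every orbit and the restriction of the pseudogroup to `U` is generated by a finite
symmetric set `E`, each `g ∈ E` being the restriction of a member of the pseudogroup whose domain
is a neighborhood of the closure in `Z` of the domain of `g`. -/
def IsCompactlyGenerated (H : StructureGroupoid Z) [ClosedUnderRestriction H] : Prop :=
  ∃ U : Opens Z, IsCompact (closure (U : Set Z)) ∧
    (∀ x, (orbit H x ∩ (U : Set Z)).Nonempty) ∧
    ∃ E : Set (OpenPartialHomeomorph U U), E.Finite ∧ IsSymmetric E ∧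
      generatedPseudogroup E = restrictToOpen H U ∧
      ∀ g ∈ E, ∃ h ∈ H, closure (Subtype.val '' g.source) ⊆ h.source ∧
        ∀ x ∈ g.source, h x = g x

/-- A pseudogroup is quasi-effective if it is generated by some symmetric set closed under
compositions whose elements are the identity on their domains as soon as they are the identity on
some non-empty open subset of their domains. -/
def IsQuasiEffective (H : StructureGroupoid Z) : Prop :=
  ∃ S : Set (OpenPartialHomeomorph Z Z),
    IsSymmetric S ∧ IsClosedUnderComposition S ∧ generatedPseudogroup S = H ∧
    ∀ h ∈ S, ∀ O : Set Z, IsOpen O → O.Nonempty → O ⊆ h.source →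
      (∀ x ∈ O, h x = x) → ∀ x ∈ h.source, h x = x

/-- A cover of a topological space by quasi-locally equal metric spaces which induces the given
topology. Equivalently, it represents a quasi-local metric inducing the topology: the open
balls of the metric spaces `part i` form a base of the topology if and only if every `part i` is
open and its metric induces the subspace topology. -/
structure QuasiLocalMetricCover (Z : Type u) [TopologicalSpace Z] where
  /-- the index set -/
  ι : Type u
  /-- the sets of the cover -/
  part : ι → Set Z
  /-- the metrics on the sets of the cover -/
  metric : ∀ i, MetricSpace (part i)
  cover : ∀ z, ∃ i, z ∈ part i
  isOpen_part : ∀ i, IsOpen (part i)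
  induces_topology : ∀ i,
    (metric i).toUniformSpace.toTopologicalSpace = instTopologicalSpaceSubtype
  /-- `δ ε` works for all indices and all points, and the neighborhood `V` works for all `ε` -/
  quasi_locally_equal : ∃ δ : ℝ → ℝ, (∀ ε > 0, 0 < δ ε) ∧
    ∀ i j, ∀ z ∈ part i ∩ part j, ∃ V : Set Z, IsOpen V ∧ z ∈ V ∧ V ⊆ part i ∩ part j ∧
      ∀ ε > 0, ∀ (x y : Z) (hxi : x ∈ part i) (hyi : y ∈ part i)
        (hxj : x ∈ part j) (hyj : y ∈ part j), x ∈ V → y ∈ V →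
        (metric i).dist ⟨x, hxi⟩ ⟨y, hyi⟩ < δ ε → (metric j).dist ⟨x, hxj⟩ ⟨y, hyj⟩ < ε

/-- A pseudogroup on a topological space is strongly equicontinuous if, for some quasi-local metric
inducing the topology and some cover representing it, some symmetric set of generators closed
under compositions is uniformly equicontinuous between the metric spaces of the cover. -/
def IsStronglyEquicontinuous (H : StructureGroupoid Z) : Prop :=
  ∃ (M : QuasiLocalMetricCover Z) (S : Set (OpenPartialHomeomorph Z Z)),
    IsSymmetric S ∧ IsClosedUnderComposition S ∧ generatedPseudogroup S = H ∧
    ∀ ε > 0, ∃ δ > 0, ∀ h ∈ S, ∀ (i j : M.ι) (x y : Z), x ∈ h.source → y ∈ h.source →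
      ∀ (hx : x ∈ M.part i) (hy : y ∈ M.part i) (hhx : h x ∈ M.part j) (hhy : h y ∈ M.part j),
        (M.metric i).dist ⟨x, hx⟩ ⟨y, hy⟩ < δ → (M.metric j).dist ⟨h x, hhx⟩ ⟨h y, hhy⟩ < ε

/-- A topological space is homogeneous if the pseudogroup of all its local homeomorphisms has exactly
one orbit. -/
def IsHomogeneous (Y : Type u) [TopologicalSpace Y] : Prop :=
  ∃! O : Set Y, ∃ y, O = orbit (continuousGroupoid Y) y

end Pseudogroups

/-! Foliated spaces. -/

section FoliatedSpaces

variable {n : ℕ} {X : Type u} [TopologicalSpace X]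

/-- The coordinate change from `φ` to `ψ` preserves plaques: near each point of the overlap, the
transverse coordinate of `ψ` is a continuous function of the transverse coordinate of `φ`. -/
def IsPlaquePreserving {B T T' : Type*} [TopologicalSpace B] [TopologicalSpace T]
    [TopologicalSpace T'] (φ : OpenPartialHomeomorph X (B × T))
    (ψ : OpenPartialHomeomorph X (B × T')) : Prop :=
  ∀ x ∈ φ.source ∩ ψ.source, ∃ W : Set X, IsOpen W ∧ x ∈ W ∧ W ⊆ φ.source ∩ ψ.source ∧
    ∃ t : T → T', ContinuousOn t ((fun y => (φ y).2) '' W) ∧ ∀ y ∈ W, (ψ y).2 = t (φ y).2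

/-- A foliated atlas of leaf dimension `n` on `X`, which makes `X` a foliated space: flow boxes
`U i ≃ₜ B i × T i` covering `X`, with `B i` an open ball of finite radius in `ℝⁿ` and `T i` a Polish
space, whose coordinate changes preserve plaques. -/
structure FoliatedAtlas (n : ℕ) (X : Type u) [TopologicalSpace X] where
  /-- the index set of the flow boxes -/
  ι : Type u
  /-- the transverse models -/
  T : ι → Type u
  [topT : ∀ i, TopologicalSpace (T i)]
  [polishT : ∀ i, PolishSpace (T i)]
  /-- the centers of the balls -/
  center : ι → EuclideanSpace ℝ (Fin n)
  /-- the radii of the balls -/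
  radius : ι → ℝ
  radius_pos : ∀ i, 0 < radius i
  /-- the flow boxes; the domain of the chart is the open set `U i` -/
  chart : ∀ i, OpenPartialHomeomorph X (EuclideanSpace ℝ (Fin n) × T i)
  target_chart : ∀ i, (chart i).target = Metric.ball (center i) (radius i) ×ˢ univ
  cover : ∀ x, ∃ i, x ∈ (chart i).source
  plaquePreserving : ∀ i j, IsPlaquePreserving (chart i) (chart j)

attribute [instance] FoliatedAtlas.topT FoliatedAtlas.polishT

namespace FoliatedAtlas

/-- Two foliated atlases define the same foliated structure if all coordinate changes between them,
in both directions, preserve plaques. -/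
def Compatible (F F' : FoliatedAtlas n X) : Prop :=
  ∀ (i : F.ι) (j : F'.ι), IsPlaquePreserving (F.chart i) (F'.chart j) ∧
    IsPlaquePreserving (F'.chart j) (F.chart i)

/-- The projection of the flow box `i` to the transverse model, whose fibers are the plaques. -/
def proj (F : FoliatedAtlas n X) (i : F.ι) (x : X) : F.T i := (F.chart i x).2

/-- The topology on `X` whose basic open sets are the open subsets of the plaques. -/
abbrev leafTopology (F : FoliatedAtlas n X) : TopologicalSpace X :=
  generateFrom {s | ∃ (i : F.ι) (z : F.T i) (D : Set (EuclideanSpace ℝ (Fin n))), IsOpen D ∧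
    s = (F.chart i).source ∩ F.chart i ⁻¹' (D ×ˢ {z})}

/-- The leaf through `x`: its connected component in the leaf topology. -/
def leaf (F : FoliatedAtlas n X) (x : X) : Set X :=
  @connectedComponent X F.leafTopology x

/-- The holonomy pseudogroup induced by the atlas on the disjoint union of the transverse models:
it is generated by the local transformations `h` from `T i` to `T j` such that
`proj j = h ∘ proj i` on some open set contained in the domains of both flow boxes, the domain of `h`
being the projection of that open set. -/
def holonomyPseudogroup (F : FoliatedAtlas n X) : StructureGroupoid (Σ i, F.T i) :=
  generatedPseudogroup {h | ∃ (i j : F.ι) (W : Set X), IsOpen W ∧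
    W ⊆ (F.chart i).source ∩ (F.chart j).source ∧
    h.source = Sigma.mk i '' (F.proj i '' W) ∧
    ∀ x ∈ W, h ⟨i, F.proj i x⟩ = ⟨j, F.proj j x⟩}

/-- A foliated space is strongly equicontinuous if some representative of its holonomy pseudogroup,
that is, the one induced by some atlas of the foliated structure, is strongly equicontinuous. -/
def StronglyEquicontinuous (F : FoliatedAtlas n X) : Prop :=
  ∃ F' : FoliatedAtlas n X, F.Compatible F' ∧ IsStronglyEquicontinuous F'.holonomyPseudogroup

/-- A foliated space is quasi-effective if some representative of its holonomy pseudogroup,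
that is, the one induced by some atlas of the foliated structure, is quasi-effective. -/
def QuasiEffective (F : FoliatedAtlas n X) : Prop :=
  ∃ F' : FoliatedAtlas n X, F.Compatible F' ∧ IsQuasiEffective F'.holonomyPseudogroup

end FoliatedAtlas

end FoliatedSpaces

end LocalTransformations

/-! An orbit closure `K` is homogeneous once a fixed point `x` of `K` is carried to every `y` in `K`
by a local homeomorphism preserving `K`. Orbit points near `y` are images of `x` under members of
the pseudogroup, but the domains of these maps could shrink along the way, so the crux is a common
domain. Compact generation factors the moves into steps by finitely many generators, and compactness
gives one radius `r` on which every step is implemented by an element of the equicontinuous set `S`,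
with the identity adjoined (`exists_isControlledStep`). Composites stay in this set, so their
modulus of continuity does not depend on their length. If a composite maps the `δ`-ball about `x`
into the `r`-ball about its endpoint, the next step is defined there, and equicontinuity of the
longer composite puts the new image back into an `r`-ball. Thus all chains live on one `δ`-ball
(`IsChain.ball_subset`). Inverse chains obey the same bound, so a limit along an ultrafilter is a
local homeomorphism, and it preserves `K` because `K` is closed and invariant
(`exists_openPartialHomeomorph_limit`).

For a leaf closure the same core, `exists_openPartialHomeomorph_of_mem_closure`, runs on the
transverse models. The steps are changes of flow box over a finite compact cover of `X`, and
connectedness of the leaf supplies the chains. The transverse limit, multiplied by a translation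
along the plaques, is the required local homeomorphism of `X`. -/

namespace LocalTransformations

open Filter Topology

/-! ### Germs in generated pseudogroups, and orbits. -/

section GeneratedPseudogroups

variable {Z : Type u} [TopologicalSpace Z]

/-- A property of germs that holds for the identity, for a set of generators and their inverses,
and passes to composites, holds for all members of the generated pseudogroup. -/
theorem generatedPseudogroup_induction {E : Set (OpenPartialHomeomorph Z Z)}
    (P : (Z → Z) → Z → Prop) (hid : ∀ x, P id x)
    (hcomp : ∀ f g x, P f x → P g (f x) → P (g ∘ f) x)
    (hcongr : ∀ f g x, f =ᶠ[𝓝 x] g → P f x → P g x)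
    (hE : ∀ e ∈ E, ∀ x ∈ e.source, P e x) (hE' : ∀ e ∈ E, ∀ x ∈ e.target, P e.symm x)
    {e : OpenPartialHomeomorph Z Z} (he : e ∈ generatedPseudogroup E) :
    ∀ x ∈ e.source, P e x := by
  -- The maps which, together with their inverses, satisfy `P` at every point of their domains form
  -- a pseudogroup containing `E`, hence one containing the generated pseudogroup.
  let G : Pregroupoid Z :=
    { property := fun f u => ∀ x ∈ u, P f x
      comp := fun hf hg _ _ _ x hx => hcomp _ _ _ (hf x hx.1) (hg _ hx.2)
      id_mem := fun x _ => hid x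
      locality := fun _ h x hx => by
        obtain ⟨v, -, hxv, hv⟩ := h x hx
        exact hv x ⟨hx, hxv⟩
      congr := fun {f g u} hu hfg hf x hx =>
        hcongr f g x (by filter_upwards [hu.mem_nhds hx] with y hy using (hfg y hy).symm)
          (hf x hx) }
  have hG : G.groupoid ∈ {G | ClosedUnderRestriction G ∧ ∀ e ∈ E, e ∈ G} := by
    refine ⟨⟨fun {e} h s hs => ?_⟩, fun e h => mem_groupoid_of_pregroupoid.2 ⟨hE e h, hE' e h⟩⟩
    rw [mem_groupoid_of_pregroupoid] at h ⊢
    exact ⟨fun x hx => h.1 x hx.1, fun x hx => h.2 x hx.1⟩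
  exact (mem_groupoid_of_pregroupoid.1 ((sInf_le hG : generatedPseudogroup E ≤ G.groupoid) he)).1

theorem mem_generatedPseudogroup {E : Set (OpenPartialHomeomorph Z Z)}
    {e : OpenPartialHomeomorph Z Z} (he : e ∈ E) : e ∈ generatedPseudogroup E :=
  mem_iInter₂.2 fun _ hG => hG.2 e he

/-- Members of a pseudogroup generated by `S` coincide locally with members of `S`, if `S` is
symmetric, closed under composition and contains the identity. -/
theorem exists_eventuallyEq_of_mem_generatedPseudogroup {S : Set (OpenPartialHomeomorph Z Z)}
    (hsymm : IsSymmetric S) (hcomp : IsClosedUnderComposition S)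
    {e : OpenPartialHomeomorph Z Z} (he : e ∈ generatedPseudogroup S) {x : Z} (hx : x ∈ e.source) :
    ∃ s ∈ insert (OpenPartialHomeomorph.refl Z) S, x ∈ s.source ∧ e =ᶠ[𝓝 x] s := by
  -- The identity is adjoined to `S`, which is not assumed to contain it: identity germs need a
  -- representative.
  refine generatedPseudogroup_induction
    (fun f x => ∃ s ∈ insert (OpenPartialHomeomorph.refl Z) S, x ∈ s.source ∧ f =ᶠ[𝓝 x] s)
    (fun x => ⟨_, mem_insert _ _, mem_univ x, .rfl⟩) ?_ ?_
    (fun s hs x hx => ⟨s, mem_insert_of_mem _ hs, hx, .rfl⟩)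
    (fun s hs x hx => ⟨s.symm, mem_insert_of_mem _ (hsymm s hs), hx, .rfl⟩) he x hx
  · rintro f g x ⟨s, hs, hxs, hfs⟩ ⟨t, ht, hxt, hgt⟩
    refine ⟨s.trans t, ?_, ?_, ?_⟩
    · rcases hs with rfl | hs
      · simpa using ht
      · rcases ht with rfl | ht
        · simpa using Or.inr hs
        · exact mem_insert_of_mem _ (hcomp s hs t ht)
    · rw [OpenPartialHomeomorph.trans_source]
      exact ⟨hxs, by rw [mem_preimage, ← hfs.eq_of_nhds]; exact hxt⟩
    · have h1 : Tendsto f (𝓝 x) (𝓝 (f x)) := by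
        have := (s.continuousAt hxs).tendsto
        rw [← hfs.eq_of_nhds] at this
        exact this.congr' hfs.symm
      filter_upwards [h1.eventually hgt, hfs] with y hy hy'
      simp only [Function.comp_apply, OpenPartialHomeomorph.coe_trans]
      rw [hy, hy']
  · rintro f g x hfg ⟨s, hs, hxs, hfs⟩
    exact ⟨s, hs, hxs, hfg.symm.trans hfs⟩

/-- Members of a pseudogroup generated by a symmetric set move points along finite chains of
generators. -/
theorem reflTransGen_of_mem_generatedPseudogroup {E : Set (OpenPartialHomeomorph Z Z)}
    (hsymm : IsSymmetric E) {e : OpenPartialHomeomorph Z Z} (he : e ∈ generatedPseudogroup E)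
    {x : Z} (hx : x ∈ e.source) :
    Relation.ReflTransGen (fun p q => ∃ g ∈ E, p ∈ g.source ∧ g p = q) x (e x) := by
  refine generatedPseudogroup_induction
    (fun f x => Relation.ReflTransGen (fun p q => ∃ g ∈ E, p ∈ g.source ∧ g p = q) x (f x))
    (fun x => .refl) (fun f g x hf hg => hf.trans hg) (fun f g x hfg hf => hfg.eq_of_nhds ▸ hf)
    (fun g hg x hx => .single ⟨g, hg, hx, rfl⟩)
    (fun g hg x hx => .single ⟨g.symm, hsymm g hg, hx, rfl⟩) he x hx

theorem mem_orbit_symm {H : StructureGroupoid Z} {x y : Z} (h : y ∈ orbit H x) :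
    x ∈ orbit H y := by
  obtain ⟨e, he, hx, rfl⟩ := h
  exact ⟨e.symm, H.symm he, e.map_source hx, e.left_inv hx⟩

theorem mem_orbit_trans {H : StructureGroupoid Z} {x y z : Z} (h : y ∈ orbit H x)
    (h' : z ∈ orbit H y) : z ∈ orbit H x := by
  obtain ⟨e, he, hx, rfl⟩ := h
  obtain ⟨e', he', hx', rfl⟩ := h'
  exact ⟨e.trans e', H.trans he he', by simp [hx, hx'], rfl⟩

/-- Closures of orbits are invariant. -/
theorem map_mem_closure_orbit {H : StructureGroupoid Z} {x : Z} {h : OpenPartialHomeomorph Z Z}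
    (hH : h ∈ H) {z : Z} (hz : z ∈ h.source) (hzx : z ∈ closure (orbit H x)) :
    h z ∈ closure (orbit H x) := by
  rw [mem_closure_iff_frequently] at hzx ⊢
  refine (h.continuousAt hz).tendsto.frequently
    ((hzx.and_eventually (h.open_source.mem_nhds hz)).mono ?_)
  rintro w ⟨hw, hws⟩
  exact mem_orbit_trans hw ⟨h, hH, hws, rfl⟩

theorem map_mem_closure_orbit_iff {H : StructureGroupoid Z} {x : Z}
    {h : OpenPartialHomeomorph Z Z} (hH : h ∈ H) {z : Z} (hz : z ∈ h.source) :
    z ∈ closure (orbit H x) ↔ h z ∈ closure (orbit H x) := by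
  refine ⟨map_mem_closure_orbit hH hz, fun hzx => ?_⟩
  simpa [hz] using map_mem_closure_orbit (H.symm hH) (h.map_source hz) hzx

/-- A point of `U` is moved to a point of `U` by the restriction of a pseudogroup to `U` if it is
moved there by the pseudogroup. -/
theorem mem_orbit_restrictToOpen {H : StructureGroupoid Z} [ClosedUnderRestriction H]
    {U : Opens Z} {x y : U} (h : (y : Z) ∈ orbit H x) : y ∈ orbit (restrictToOpen H U) x := by
  obtain ⟨h, hH, hx, hxy⟩ := h
  let c := U.openPartialHomeomorphSubtypeCoe ⟨x⟩
  have hc : ∀ x : U, c.symm (x : Z) = x := fun x => c.left_inv (mem_univ x)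
  let e : OpenPartialHomeomorph U U := c.trans (h.trans c.symm)
  have hes : ∀ z : U, z ∈ e.source ↔ (z : Z) ∈ h.source ∧ h z ∈ U := by
    intro z
    simp [e, c]
  have he : ∀ z : U, z ∈ e.source → h z = e z := by
    intro z hz
    change h z = (c.symm (h z) : U)
    rw [show h z = ((⟨h z, ((hes z).1 hz).2⟩ : U) : Z) from rfl, hc]
  have ho : IsOpen (Subtype.val '' e.source : Set Z) :=
    U.isOpen.isOpenMap_subtype_val _ e.open_source
  have hxe : x ∈ e.source := (hes x).2 ⟨hx, by rw [hxy]; exact y.2⟩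
  refine ⟨e, ⟨h.restr (Subtype.val '' e.source), closedUnderRestriction' hH ho, ?_, he⟩, hxe,
    Subtype.ext ((he x hxe).symm.trans hxy)⟩
  rw [OpenPartialHomeomorph.restr_source, ho.interior_eq]
  refine inter_eq_right.2 ?_
  rintro _ ⟨z, hz, rfl⟩
  exact ((hes z).1 hz).1

end GeneratedPseudogroups

/-! ### Homogeneity of subsets. -/

section Homogeneity

variable {Y : Type u} [TopologicalSpace Y]

/-- A local homeomorphism that preserves a subset restricts to a local homeomorphism of it. -/
noncomputable def restrictToSubset (e : OpenPartialHomeomorph Y Y) (K : Set Y)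
    (h : ∀ z ∈ e.source, z ∈ K ↔ e z ∈ K) : OpenPartialHomeomorph K K := by
  classical
  exact
  -- Off the domain the value is junk; `z` itself is at hand as a point of `K`.
  { toFun := fun z => if hz : (z : Y) ∈ e.source then ⟨e z, (h z hz).1 z.2⟩ else z
    invFun := fun z => if hz : (z : Y) ∈ e.target then
      ⟨e.symm z, (h _ (e.map_target hz)).2 (by rw [e.right_inv hz]; exact z.2)⟩ else z
    source := Subtype.val ⁻¹' e.source
    target := Subtype.val ⁻¹' e.target
    map_source' := fun z hz => by
      have hz' : (z : Y) ∈ e.source := hz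
      simp only [hz', dif_pos, mem_preimage]
      exact e.map_source hz'
    map_target' := fun z hz => by
      have hz' : (z : Y) ∈ e.target := hz
      simp only [hz', dif_pos, mem_preimage]
      exact e.map_target hz'
    left_inv' := fun z hz => by
      have hz' : (z : Y) ∈ e.source := hz
      simp [hz']
    right_inv' := fun z hz => by
      have hz' : (z : Y) ∈ e.target := hz
      simp [hz']
    open_source := e.open_source.preimage continuous_subtype_val
    open_target := e.open_target.preimage continuous_subtype_val
    continuousOn_toFun := by
      refine continuousOn_iff_continuous_domRestrict.2 (Continuous.subtype_mk (f := fun z :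
        (Subtype.val ⁻¹' e.source : Set K) => e (z : K)) ?_ (fun z => (h _ z.2).1 z.1.2) |>.congr ?_)
      · exact e.continuousOn.comp_continuous (by fun_prop) fun z => z.2
      · intro z
        have hz' : ((z : K) : Y) ∈ e.source := z.2
        simp [hz']
    continuousOn_invFun := by
      refine continuousOn_iff_continuous_domRestrict.2 (Continuous.subtype_mk (f := fun z :
        (Subtype.val ⁻¹' e.target : Set K) => e.symm (z : K)) ?_
        (fun z => (h _ (e.map_target z.2)).2 (by rw [e.right_inv z.2]; exact z.1.2)) |>.congr ?_)
      · exact e.symm.continuousOn.comp_continuous (by fun_prop) fun z => z.2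
      · intro z
        have hz' : ((z : K) : Y) ∈ e.target := z.2
        simp [hz'] }

/-- A subset `K` is homogeneous if local homeomorphisms of the ambient space that preserve `K`
move one of its points to all others. -/
theorem isHomogeneous_of_exists {K : Set Y} {x : Y} (hx : x ∈ K)
    (h : ∀ y ∈ K, ∃ e : OpenPartialHomeomorph Y Y, x ∈ e.source ∧ e x = y ∧
      ∀ z ∈ e.source, z ∈ K ↔ e z ∈ K) : IsHomogeneous K := by
  have key : ∀ y : K, y ∈ orbit (continuousGroupoid K) ⟨x, hx⟩ := by
    rintro ⟨y, hy⟩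
    obtain ⟨e, hxe, rfl, he⟩ := h y hy
    refine ⟨restrictToSubset e K he, by rw [continuousGroupoid]; trivial, hxe, ?_⟩
    simp [restrictToSubset, hxe]
  refine ⟨univ, ⟨⟨x, hx⟩, (eq_univ_of_forall key).symm⟩, ?_⟩
  rintro _ ⟨y, rfl⟩
  exact eq_univ_of_forall fun z => mem_orbit_trans (mem_orbit_symm (key y)) (key z)

end Homogeneity

/-! ### From the metrics of the cover to one metric on compact sets. -/

section Equicontinuity

variable {Z : Type u} [MetricSpace Z]

/-- Two points of a compact set that are close to each other are close with respect to some
metric of a given cover. -/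
theorem QuasiLocalMetricCover.exists_dist_lt (M : QuasiLocalMetricCover Z) {C : Set Z}
    (hC : IsCompact C) {ε : ℝ} (hε : 0 < ε) :
    ∃ δ > 0, ∀ z ∈ C, ∀ w, dist z w < δ → ∃ (i : M.ι) (hz : z ∈ M.part i) (hw : w ∈ M.part i),
      (M.metric i).dist ⟨z, hz⟩ ⟨w, hw⟩ < ε := by
  -- Below a Lebesgue number of the cover by these balls, `z` and `w` lie in a common ball of radius
  -- `ε / 2`.
  let B : (Σ i, M.part i) → Set Z := fun p =>
    Subtype.val '' @Metric.ball _ (M.metric p.1).toPseudoMetricSpace p.2 (ε / 2)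
  have hB : ∀ p, IsOpen (B p) := by
    intro p
    refine (M.isOpen_part p.1).isOpenMap_subtype_val _ ?_
    rw [← M.induces_topology]
    exact @Metric.isOpen_ball _ (M.metric p.1).toPseudoMetricSpace _ _
  have hcov : C ⊆ ⋃ p, B p := by
    intro z _
    obtain ⟨i, hi⟩ := M.cover z
    exact mem_iUnion.2 ⟨⟨i, z, hi⟩, ⟨z, hi⟩,
      @Metric.mem_ball_self _ (M.metric i).toPseudoMetricSpace _ _ (half_pos hε), rfl⟩
  obtain ⟨δ, hδ, h⟩ := lebesgue_number_lemma_of_metric hC hB hcov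
  refine ⟨δ, hδ, fun z hz w hzw => ?_⟩
  obtain ⟨p, hp⟩ := h z hz
  obtain ⟨z', hz', rfl⟩ := hp (Metric.mem_ball_self hδ)
  obtain ⟨w', hw', rfl⟩ := hp (by rwa [Metric.mem_ball, dist_comm])
  refine ⟨p.1, z'.2, w'.2, ?_⟩
  have h1 : (M.metric p.1).dist z' p.2 < ε / 2 := hz'
  have h2 : (M.metric p.1).dist w' p.2 < ε / 2 := hw'
  have h3 := @dist_triangle_right _ (M.metric p.1).toPseudoMetricSpace z' w' p.2
  exact (h3.trans_lt (add_lt_add h1 h2)).trans_eq (add_halves ε)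

/-- On a compact subset of an element of the cover, closeness with respect to the metric of that
element implies closeness. -/
theorem QuasiLocalMetricCover.exists_lt_of_dist_lt (M : QuasiLocalMetricCover Z) {N : Set Z}
    (hN : IsCompact N) {j : M.ι} (hj : N ⊆ M.part j) {ε : ℝ} (hε : 0 < ε) :
    ∃ η > 0, ∀ z (hz : z ∈ N) w (hw : w ∈ N),
      (M.metric j).dist ⟨z, hj hz⟩ ⟨w, hj hw⟩ < η → dist z w < ε := by
  have hN' : IsCompact (Subtype.val ⁻¹' N : Set (M.part j)) := by
    rw [Subtype.isCompact_iff, Subtype.image_preimage_coe, inter_eq_right.2 hj]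
    exact hN
  -- The inclusion into `Z` is continuous for the metric of the part, hence uniformly continuous on
  -- the compact preimage of `N`.
  have hcont : @Continuous _ _ (M.metric j).toUniformSpace.toTopologicalSpace _
      (Subtype.val : M.part j → Z) := by
    rw [M.induces_topology]; exact continuous_subtype_val
  rw [← M.induces_topology] at hN'
  have hu := @IsCompact.uniformContinuousOn_of_continuous _ _ (M.metric j).toUniformSpace _ _ _ hN'
    (@Continuous.continuousOn _ _ (M.metric j).toUniformSpace.toTopologicalSpace _ _ _ hcont)
  obtain ⟨η, hη, h⟩ :=
    (@Metric.uniformContinuousOn_iff _ _ (M.metric j).toPseudoMetricSpace _ _ _).1 hu ε hε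
  exact ⟨η, hη, fun z hz w hw hzw => h ⟨z, hj hz⟩ hz ⟨w, hj hw⟩ hw hzw⟩

/-- Small sets that meet a compact set lie in a compact subset of some element of the cover, where
closeness with respect to the metric of that element implies closeness. -/
theorem QuasiLocalMetricCover.exists_dist_lt_of_lt [LocallyCompactSpace Z]
    (M : QuasiLocalMetricCover Z) {C : Set Z} (hC : IsCompact C) :
    ∃ r > 0, ∀ ε > 0, ∃ η > 0, ∀ z ∈ C, ∀ w, dist z w < r →
      ∃ (j : M.ι) (hz : z ∈ M.part j) (hw : w ∈ M.part j),
        (M.metric j).dist ⟨z, hz⟩ ⟨w, hw⟩ < η → dist z w < ε := by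
  choose j hj using M.cover
  choose N hN hNj hNc using fun z =>
    local_compact_nhds ((M.isOpen_part (j z)).mem_nhds (hj z))
  obtain ⟨t, -, ht⟩ := hC.elim_nhds_subcover (fun z => interior (N z))
    fun z _ => interior_mem_nhds.2 (hN z)
  obtain ⟨r, hr, h⟩ := lebesgue_number_lemma_of_metric (c := fun z : t => interior (N z)) hC
    (fun _ => isOpen_interior) (by simpa [iUnion_subtype] using ht)
  -- The compact pieces, and with them `r`, are fixed before `ε`; only `η` depends on `ε`.
  refine ⟨r, hr, fun ε hε => ?_⟩
  choose η hη hηd using fun z => M.exists_lt_of_dist_lt (hNc z) (hNj z) hε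
  -- The extra `1` keeps the minimum defined when `t` is empty.
  have hne : (insert (1 : ℝ) (t.image η)).Nonempty := Finset.insert_nonempty _ _
  refine ⟨(insert (1 : ℝ) (t.image η)).min' hne, ?_, fun z hz w hzw => ?_⟩
  · rw [gt_iff_lt, Finset.lt_min'_iff]
    simp only [Finset.mem_insert, Finset.mem_image, forall_eq_or_imp, forall_exists_index, and_imp,
      forall_apply_eq_imp_iff₂]
    exact ⟨one_pos, fun z _ => hη z⟩
  · obtain ⟨p, hp⟩ := h z hz
    have hz' := interior_subset (hp (Metric.mem_ball_self hr))
    have hw' := interior_subset (hp (by rwa [Metric.mem_ball, dist_comm] : w ∈ Metric.ball z r))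
    refine ⟨j p, hNj p hz', hNj p hw', fun hd => hηd p z hz' w hw' (hd.trans_le ?_)⟩
    exact Finset.min'_le _ _ (Finset.mem_insert_of_mem (Finset.mem_image_of_mem _ p.2))

/-- Equicontinuity of a set of local transformations on a compact set `C`, up to jumps of size at
least `r`. -/
def IsEquicontinuousUpTo (S : Set (OpenPartialHomeomorph Z Z)) (C : Set Z) (r : ℝ) : Prop :=
  ∀ ε > 0, ∃ δ > 0, ∀ s ∈ S, ∀ z ∈ C, ∀ w ∈ C, z ∈ s.source → w ∈ s.source → s z ∈ C → s w ∈ C →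
    dist z w < δ → dist (s z) (s w) < r → dist (s z) (s w) < ε

/-- Close points share a part of the cover, but their images may not, and then the hypothesis says
nothing about them. Images closer than `r` do share a part whose metric controls `dist`, which is
why the conclusion excludes jumps. -/
theorem exists_isEquicontinuousUpTo [LocallyCompactSpace Z] (M : QuasiLocalMetricCover Z)
    {S : Set (OpenPartialHomeomorph Z Z)}
    (hS : ∀ ε > 0, ∃ δ > 0, ∀ h ∈ S, ∀ (i j : M.ι) (x y : Z), x ∈ h.source → y ∈ h.source →
      ∀ (hx : x ∈ M.part i) (hy : y ∈ M.part i) (hhx : h x ∈ M.part j) (hhy : h y ∈ M.part j),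
        (M.metric i).dist ⟨x, hx⟩ ⟨y, hy⟩ < δ → (M.metric j).dist ⟨h x, hhx⟩ ⟨h y, hhy⟩ < ε)
    {C : Set Z} (hC : IsCompact C) :
    ∃ r > 0, IsEquicontinuousUpTo (insert (OpenPartialHomeomorph.refl Z) S) C r := by
  obtain ⟨r, hr, h⟩ := M.exists_dist_lt_of_lt hC
  refine ⟨r, hr, fun ε hε => ?_⟩
  obtain ⟨η, hη, hηd⟩ := h ε hε
  obtain ⟨δ, hδ, hδd⟩ := hS η hη
  obtain ⟨δ', hδ', hδd'⟩ := M.exists_dist_lt hC hδ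
  refine ⟨min δ' ε, lt_min hδ' hε, ?_⟩
  rintro s (rfl | hs) z hz w hw hzs hws hsz hsw hzw hszw
  · exact hzw.trans_le (min_le_right _ _)
  · obtain ⟨i, hzi, hwi, hi⟩ := hδd' z hz w (hzw.trans_le (min_le_left _ _))
    obtain ⟨j, hzj, hwj, hj⟩ := hηd _ hsz _ hszw
    exact hj (hδd s hs i j z w hzs hws hzi hwi hzj hwj hi)

end Equicontinuity

/-! ### Chains of controlled steps and their common domain. -/

section Chains

variable {Z : Type u} [MetricSpace Z]

/-- `s` moves `p ∈ C` to `q ∈ C`, and `s` and its inverse are defined on the balls of radius `r`,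
which they map into balls of radius `R`. -/
structure IsControlledStep (S : Set (OpenPartialHomeomorph Z Z)) (C : Set Z) (r R : ℝ)
    (s : OpenPartialHomeomorph Z Z) (p q : Z) : Prop where
  mem : s ∈ S
  left_mem : p ∈ C
  right_mem : q ∈ C
  mem_source : p ∈ s.source
  apply_eq : s p = q
  ball_subset_source : Metric.ball p r ⊆ s.source
  ball_subset_target : Metric.ball q r ⊆ s.target
  mapsTo : MapsTo s (Metric.ball p r) (Metric.ball q R)
  mapsTo_symm : MapsTo s.symm (Metric.ball q r) (Metric.ball p R)

theorem IsControlledStep.symm {S : Set (OpenPartialHomeomorph Z Z)} (hS : IsSymmetric S)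
    {C : Set Z} {r R : ℝ} {s : OpenPartialHomeomorph Z Z} {p q : Z}
    (h : IsControlledStep S C r R s p q) : IsControlledStep S C r R s.symm q p where
  mem := hS s h.mem
  left_mem := h.right_mem
  right_mem := h.left_mem
  mem_source := h.apply_eq ▸ s.map_source h.mem_source
  apply_eq := by rw [← h.apply_eq, s.left_inv h.mem_source]
  ball_subset_source := h.ball_subset_target
  ball_subset_target := h.ball_subset_source
  mapsTo := h.mapsTo_symm
  mapsTo_symm := h.mapsTo

theorem IsControlledStep.mono {S : Set (OpenPartialHomeomorph Z Z)} {C : Set Z} {r r' R : ℝ}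
    {s : OpenPartialHomeomorph Z Z} {p q : Z} (h : IsControlledStep S C r' R s p q)
    (hr : r ≤ r') : IsControlledStep S C r R s p q :=
  { h with
    ball_subset_source := (Metric.ball_subset_ball hr).trans h.ball_subset_source
    ball_subset_target := (Metric.ball_subset_ball hr).trans h.ball_subset_target
    mapsTo := h.mapsTo.mono_left (Metric.ball_subset_ball hr)
    mapsTo_symm := h.mapsTo_symm.mono_left (Metric.ball_subset_ball hr) }

/-- Composites of controlled steps. -/
inductive IsChain (S : Set (OpenPartialHomeomorph Z Z)) (C : Set Z) (r R : ℝ) (x : Z) :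
    Z → OpenPartialHomeomorph Z Z → Prop
  | refl : IsChain S C r R x x (OpenPartialHomeomorph.refl Z)
  | tail {y z : Z} {h s : OpenPartialHomeomorph Z Z} : IsChain S C r R x y h →
      IsControlledStep S C r R s y z → IsChain S C r R x z (h.trans s)

variable {S : Set (OpenPartialHomeomorph Z Z)} {C : Set Z} {r R : ℝ}

theorem IsChain.trans {x y z : Z} {h k : OpenPartialHomeomorph Z Z} (hxy : IsChain S C r R x y h)
    (hyz : IsChain S C r R y z k) : IsChain S C r R x z (h.trans k) := by
  induction hyz with
  | refl => simpa using hxy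
  | tail _ hs ih => rw [← OpenPartialHomeomorph.trans_assoc]; exact ih.tail hs

theorem IsChain.symm (hS : IsSymmetric S) {x y : Z} {h : OpenPartialHomeomorph Z Z}
    (hxy : IsChain S C r R x y h) : IsChain S C r R y x h.symm := by
  induction hxy with
  | refl => simpa using IsChain.refl
  | tail _ hs ih =>
    rw [OpenPartialHomeomorph.trans_symm_eq_symm_trans_symm]
    refine IsChain.trans ?_ ih
    simpa using IsChain.refl.tail (hs.symm hS)

theorem IsChain.mem (hS : IsClosedUnderComposition S) (hid : OpenPartialHomeomorph.refl Z ∈ S)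
    {x y : Z} {h : OpenPartialHomeomorph Z Z} (hxy : IsChain S C r R x y h) : h ∈ S := by
  induction hxy with
  | refl => exact hid
  | tail _ hs ih => exact hS _ ih _ hs.mem

theorem IsChain.right_mem {x y : Z} (hx : x ∈ C) {h : OpenPartialHomeomorph Z Z}
    (hxy : IsChain S C r R x y h) : y ∈ C := by
  cases hxy with
  | refl => exact hx
  | tail _ hs => exact hs.right_mem

/-- All composites of controlled steps that start at `x` are defined on a ball about `x` whose radius
`δ` only depends on the modulus of equicontinuity. -/
theorem IsChain.ball_subset (hS : IsClosedUnderComposition S)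
    (hid : OpenPartialHomeomorph.refl Z ∈ S) {C' : Set Z} {δ : ℝ} (hδ : 0 < δ)
    (hδr : δ ≤ r) (hδR : δ ≤ R) (hball : ∀ p ∈ C, Metric.ball p R ⊆ C')
    (hequi : ∀ s ∈ S, ∀ z ∈ C', ∀ w ∈ C', z ∈ s.source → w ∈ s.source → s z ∈ C' → s w ∈ C' →
      dist z w < δ → dist (s z) (s w) < R → dist (s z) (s w) < r)
    {x y : Z} (hx : x ∈ C) {h : OpenPartialHomeomorph Z Z} (hxy : IsChain S C r R x y h) :
    h x = y ∧ ∀ w ∈ Metric.ball x δ, w ∈ h.source ∧ h w ∈ Metric.ball y r := by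
  induction hxy with
  | refl => exact ⟨rfl, fun w hw => ⟨mem_univ w, Metric.ball_subset_ball hδr hw⟩⟩
  | @tail y z h s hxy hs ih =>
    obtain ⟨ih1, ih2⟩ := ih
    have hRpos : 0 < R := hδ.trans_le hδR
    -- A crude bound by `R` comes first: it rules out jumps, so equicontinuity of the whole
    -- composite may then improve `R` to `r` and restore the induction hypothesis.
    have key : ∀ w ∈ Metric.ball x δ, w ∈ (h.trans s).source ∧ s (h w) ∈ Metric.ball z R := by
      intro w hw
      have h1 := ih2 w hw
      refine ⟨?_, hs.mapsTo h1.2⟩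
      rw [OpenPartialHomeomorph.trans_source]
      exact ⟨h1.1, hs.ball_subset_source h1.2⟩
    have hxz : (h.trans s) x = z := by
      rw [OpenPartialHomeomorph.coe_trans, Function.comp_apply, ih1, hs.apply_eq]
    refine ⟨hxz, fun w hw => ⟨(key w hw).1, ?_⟩⟩
    have h2 := (key w hw).2
    rw [Metric.mem_ball, ← hxz]
    refine hequi _ (hS _ (hxy.mem hS hid) _ hs.mem) w (hball x hx (Metric.ball_subset_ball hδR hw))
      x (hball x hx (Metric.mem_ball_self hRpos)) (key w hw).1
      (key x (Metric.mem_ball_self hδ)).1 (hball z hs.right_mem h2) ?_ hw (by rw [hxz]; exact h2)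
    rw [hxz]
    exact hball z hs.right_mem (Metric.mem_ball_self hRpos)

end Chains

/-! ### Limits of equicontinuous families. -/

section Limits

variable {Z : Type u} [MetricSpace Z]

/-- An equicontinuous limit, along an ultrafilter, of local homeomorphisms that are defined on a
common ball. -/
theorem exists_limit_of_equicontinuous {x : Z} {C : Set Z} (hC : IsCompact C) {δ : ℝ}
    (l : Ultrafilter (OpenPartialHomeomorph Z Z))
    (hmem : ∀ z ∈ Metric.ball x δ, ∀ᶠ h in (l : Filter (OpenPartialHomeomorph Z Z)), h z ∈ C)
    (hequi : ∀ ε > 0, ∃ η > 0, ∀ z ∈ Metric.ball x δ, ∀ w ∈ Metric.ball x δ, dist z w < η →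
      ∀ᶠ h in (l : Filter (OpenPartialHomeomorph Z Z)), dist (h z) (h w) < ε) :
    ∃ f : Z → Z, ContinuousOn f (Metric.ball x δ) ∧ ∀ z ∈ Metric.ball x δ,
      Tendsto (fun h : OpenPartialHomeomorph Z Z => h z) l (𝓝 (f z)) := by
  have hex : ∀ z, ∃ a, z ∈ Metric.ball x δ →
      Tendsto (fun h : OpenPartialHomeomorph Z Z => h z) l (𝓝 a) := by
    intro z
    by_cases hz : z ∈ Metric.ball x δ
    -- Along an ultrafilter the values converge at every point at once, without passing to
    -- subsequences.
    · obtain ⟨a, -, ha⟩ := hC.ultrafilter_le_nhds 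
        (l.map fun h : OpenPartialHomeomorph Z Z => h z) (le_principal_iff.2 (hmem z hz))
      exact ⟨a, fun _ => ha⟩
    · exact ⟨z, fun h => (hz h).elim⟩
  choose f hf using hex
  refine ⟨f, fun z hz => ?_, fun z hz => hf z hz⟩
  rw [Metric.continuousWithinAt_iff]
  intro ε hε
  obtain ⟨η, hη, h⟩ := hequi (ε / 2) (half_pos hε)
  refine ⟨η, hη, fun {w} hw hwz => ?_⟩
  have := le_of_tendsto ((hf w hw).dist (hf z hz)) ((h w hw z hz hwz).mono fun _ h => h.le)
  linarith

/-- Equicontinuous limits of local homeomorphisms with equicontinuous inverses are local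
homeomorphisms. -/
theorem exists_openPartialHomeomorph_limit {x y : Z} {C : Set Z} (hC : IsCompact C) {δ : ℝ}
    (hδ : 0 < δ) {F : Set (OpenPartialHomeomorph Z Z)} (hy : y ∈ closure ((fun h => h x) '' F))
    (hdom : ∀ h ∈ F, ∀ z ∈ Metric.ball x δ, z ∈ h.source ∧ h z ∈ C)
    (hran : ∀ h ∈ F, ∀ z ∈ Metric.ball (h x) δ, z ∈ h.target ∧ h.symm z ∈ C)
    (hequi : ∀ ε > 0, ∃ η > 0, ∀ h ∈ F, ∀ z ∈ Metric.ball x δ, ∀ w ∈ Metric.ball x δ,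
      dist z w < η → dist (h z) (h w) < ε)
    (hequi' : ∀ ε > 0, ∃ η > 0, ∀ h ∈ F, ∀ z ∈ Metric.ball (h x) δ, ∀ w ∈ Metric.ball (h x) δ,
      dist z w < η → dist (h.symm z) (h.symm w) < ε)
    {K : Set Z} (hK : IsClosed K) (hKF : ∀ h ∈ F, ∀ z ∈ h.source, z ∈ K ↔ h z ∈ K) :
    ∃ e : OpenPartialHomeomorph Z Z, x ∈ e.source ∧ e x = y ∧ ∀ z ∈ e.source, z ∈ K ↔ e z ∈ K := by
  obtain ⟨l, hlF, hlx⟩ : ∃ l : Ultrafilter (OpenPartialHomeomorph Z Z),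
      (∀ᶠ h in (l : Filter (OpenPartialHomeomorph Z Z)), h ∈ F) ∧
      Tendsto (fun h : OpenPartialHomeomorph Z Z => h x) l (𝓝 y) := by
    have hne : (comap (fun h : OpenPartialHomeomorph Z Z => h x) (𝓝 y) ⊓ 𝓟 F).NeBot := by
      rw [← map_neBot_iff (fun h : OpenPartialHomeomorph Z Z => h x), Filter.push_pull',
        map_principal]
      exact mem_closure_iff_clusterPt.1 hy
    refine ⟨Ultrafilter.of (comap (fun h : OpenPartialHomeomorph Z Z => h x) (𝓝 y) ⊓ 𝓟 F), ?_, ?_⟩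
    · exact Ultrafilter.of_le _ (mem_inf_of_right (mem_principal_self F))
    · exact tendsto_comap.mono_left ((Ultrafilter.of_le _).trans inf_le_left)
  -- The inverses live on balls about the moving centers `h x`; a fixed point of the ball about `y`
  -- eventually lies in them.
  have hball : ∀ ρ, ∀ z ∈ Metric.ball y ρ,
      ∀ᶠ h in (l : Filter (OpenPartialHomeomorph Z Z)), z ∈ Metric.ball (h x) ρ := by
    intro ρ z hz
    have : Tendsto (fun h : OpenPartialHomeomorph Z Z => dist z (h x)) l (𝓝 (dist z y)) :=
      tendsto_const_nhds.dist hlx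
    exact this.eventually_lt_const hz
  obtain ⟨f, hfc, hf⟩ := exists_limit_of_equicontinuous (x := x) hC l
    (fun z hz => hlF.mono fun h hh => (hdom h hh z hz).2) (fun ε hε => by
      obtain ⟨η, hη, H⟩ := hequi ε hε
      exact ⟨η, hη, fun z hz w hw hzw => hlF.mono fun h hh => H h hh z hz w hw hzw⟩)
  obtain ⟨g, hgc, hg⟩ := exists_limit_of_equicontinuous (x := y) (δ := δ) hC
    (l.map OpenPartialHomeomorph.symm)
    (fun z hz => by
      rw [Ultrafilter.coe_map, eventually_map]
      filter_upwards [hlF, hball δ z hz] with h hh hz' using (hran h hh z hz').2)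
    (fun ε hε => by
      obtain ⟨η, hη, H⟩ := hequi' ε hε
      refine ⟨η, hη, fun z hz w hw hzw => ?_⟩
      rw [Ultrafilter.coe_map, eventually_map]
      filter_upwards [hlF, hball δ z hz, hball δ w hw] with h hh hz' hw'
        using H h hh z hz' w hw' hzw)
  simp only [Ultrafilter.coe_map, tendsto_map'_iff, Function.comp_def] at hg
  have hfx : f x = y := tendsto_nhds_unique (hf x (Metric.mem_ball_self hδ)) hlx
  -- Since `h z` is close to `f z`, equicontinuity of the inverses puts `h.symm (f z)` close to
  -- `h.symm (h z) = z`.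
  have hgf : ∀ z ∈ Metric.ball x δ, f z ∈ Metric.ball y δ → g (f z) = z := by
    intro z hz hfz
    refine tendsto_nhds_unique (hg _ hfz) (Metric.tendsto_nhds.2 fun ε hε => ?_)
    obtain ⟨η, hη, H⟩ := hequi' ε hε
    filter_upwards [hlF, hball δ _ hfz, (hf z hz).eventually (Metric.ball_mem_nhds _ hη),
      ((hf z hz).dist hlx).eventually_lt_const hfz] with h hh h1 h2 h3
    have := H h hh (f z) h1 (h z) h3 (by rw [dist_comm]; exact h2)
    rwa [h.left_inv (hdom h hh z hz).1] at this
  have hfg : ∀ w ∈ Metric.ball y δ, g w ∈ Metric.ball x δ → f (g w) = w := by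
    intro w hw hgw
    refine tendsto_nhds_unique (hf _ hgw) (Metric.tendsto_nhds.2 fun ε hε => ?_)
    obtain ⟨η, hη, H⟩ := hequi ε hε
    filter_upwards [hlF, hball δ _ hw, (hg w hw).eventually (Metric.ball_mem_nhds _ hη),
      (hg w hw).eventually (Metric.isOpen_ball.mem_nhds hgw)] with h hh h1 h2 h3
    have := H h hh (g w) hgw (h.symm w) h3 (by rw [dist_comm]; exact h2)
    rwa [h.right_inv (hran h hh w h1).1] at this
  let e : OpenPartialHomeomorph Z Z :=
    { toFun := f
      invFun := g
      source := Metric.ball x δ ∩ f ⁻¹' Metric.ball y δ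
      target := Metric.ball y δ ∩ g ⁻¹' Metric.ball x δ
      map_source' := fun z hz => ⟨hz.2, by rw [mem_preimage, hgf z hz.1 hz.2]; exact hz.1⟩
      map_target' := fun z hz => ⟨hz.2, by rw [mem_preimage, hfg z hz.1 hz.2]; exact hz.1⟩
      left_inv' := fun z hz => hgf z hz.1 hz.2
      right_inv' := fun z hz => hfg z hz.1 hz.2
      open_source := hfc.isOpen_inter_preimage Metric.isOpen_ball Metric.isOpen_ball
      open_target := hgc.isOpen_inter_preimage Metric.isOpen_ball Metric.isOpen_ball
      continuousOn_toFun := hfc.mono inter_subset_left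
      continuousOn_invFun := hgc.mono inter_subset_left }
  refine ⟨e, ⟨Metric.mem_ball_self hδ, ?_⟩, hfx, fun z hz => ⟨fun hzK => ?_, fun hzK => ?_⟩⟩
  · rw [mem_preimage, hfx]
    exact Metric.mem_ball_self hδ
  · exact hK.mem_of_tendsto (hf z hz.1)
      (hlF.mono fun h hh => (hKF h hh z (hdom h hh z hz.1).1).1 hzK)
  · rw [← hgf z hz.1 hz.2]
    refine hK.mem_of_tendsto (hg _ hz.2) ?_
    filter_upwards [hlF, hball δ _ hz.2] with h hh h1
    have h2 := (hran h hh _ h1).1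
    rw [hKF h hh _ (h.map_target h2), h.right_inv h2]
    exact hzK

end Limits

/-! ### Uniform control of steps, and the core extension argument. -/

section Core

variable {Z : Type u} [MetricSpace Z]

/-- Steps between points of a compact set along compact families of germs of local transformations
are uniformly controlled. -/
theorem exists_isControlledStep {S : Set (OpenPartialHomeomorph Z Z)} {C : Set Z}
    {Q : Type v} [TopologicalSpace Q] {D : Set Q} (hD : IsCompact D) {a b : Q → Z}
    (ha : ContinuousOn a D) (hb : ContinuousOn b D) (haC : MapsTo a D C) (hbC : MapsTo b D C)
    (h : ∀ q ∈ D, ∃ s ∈ S, a q ∈ s.source ∧ ∀ᶠ q' in 𝓝[D] q, s (a q') = b q') {R : ℝ}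
    (hR : 0 < R) :
    ∃ r > 0, ∀ q ∈ D, ∃ s, IsControlledStep S C r R s (a q) (b q) := by
  -- Membership in `D` is stated twice because compactness induction replaces the first `D` by an
  -- arbitrary set.
  suffices ∃ r > 0, ∀ q ∈ D, q ∈ D → ∃ s, IsControlledStep S C r R s (a q) (b q) by
    obtain ⟨r, hr, h⟩ := this
    exact ⟨r, hr, fun q hq => h q hq hq⟩
  refine hD.induction_on
    (p := fun D' => ∃ r > 0, ∀ q ∈ D', q ∈ D → ∃ s, IsControlledStep S C r R s (a q) (b q))
    ⟨1, one_pos, by simp⟩ ?_ ?_ ?_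
  · rintro s t hst ⟨r, hr, h⟩
    exact ⟨r, hr, fun q hq => h q (hst hq)⟩
  · rintro s t ⟨r, hr, h⟩ ⟨r', hr', h'⟩
    refine ⟨min r r', lt_min hr hr', ?_⟩
    rintro q (hq | hq) hqD
    · exact (h q hq hqD).imp fun s hs => hs.mono (min_le_left _ _)
    · exact (h' q hq hqD).imp fun s hs => hs.mono (min_le_right _ _)
  · intro q hq
    obtain ⟨s, hs, hqs, hsab⟩ := h q hq
    have hsq : s (a q) = b q := hsab.self_of_nhdsWithin hq
    have hqt : b q ∈ s.target := hsq ▸ s.map_source hqs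
    have hsymm : s.symm (b q) = a q := by rw [← hsq, s.left_inv hqs]
    have aux : ∀ (t : OpenPartialHomeomorph Z Z) (p p' : Z), p ∈ t.source → t p = p' →
        ∃ ρ > 0, Metric.ball p ρ ⊆ t.source ∧ MapsTo t (Metric.ball p ρ) (Metric.ball p' (R / 2)) := by
      intro t p p' hp hpp'
      have h1 : t.source ∩ t ⁻¹' Metric.ball p' (R / 2) ∈ 𝓝 p :=
        inter_mem (t.open_source.mem_nhds hp) (t.continuousAt hp
          (hpp' ▸ Metric.ball_mem_nhds _ (half_pos hR)))
      obtain ⟨ρ, hρ, h⟩ := Metric.mem_nhds_iff.1 h1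
      exact ⟨ρ, hρ, fun z hz => (h hz).1, fun z hz => (h hz).2⟩
    obtain ⟨ρ, hρ, hρs, hρm⟩ := aux s _ _ hqs hsq
    obtain ⟨ρ', hρ', hρs', hρm'⟩ := aux s.symm _ _ hqt hsymm
    -- Half of each radius pays for moving the center from `q` to `q'`: `ρ / 2` and `ρ' / 2` on the
    -- domains, `R / 2` on the images.
    refine ⟨_, inter_mem (inter_mem hsab (ha q hq (Metric.ball_mem_nhds _
      (lt_min (half_pos hρ) (half_pos hR))))) (hb q hq (Metric.ball_mem_nhds _
      (lt_min (half_pos hρ') (half_pos hR)))), min (ρ / 2) (ρ' / 2), by positivity, ?_⟩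
    rintro q' ⟨⟨h1, h2⟩, h3⟩ hq'
    rw [mem_preimage, Metric.mem_ball, lt_min_iff] at h2 h3
    have hsub : Metric.ball (a q') (min (ρ / 2) (ρ' / 2)) ⊆ Metric.ball (a q) ρ :=
      Metric.ball_subset_ball' (by linarith [min_le_left (ρ / 2) (ρ' / 2)])
    have hsub' : Metric.ball (b q') (min (ρ / 2) (ρ' / 2)) ⊆ Metric.ball (b q) ρ' :=
      Metric.ball_subset_ball' (by linarith [min_le_right (ρ / 2) (ρ' / 2)])
    have hpos : 0 < min (ρ / 2) (ρ' / 2) := by positivity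
    refine ⟨s, hs, haC hq', hbC hq', hρs (hsub (Metric.mem_ball_self hpos)), h1, hsub.trans hρs,
      hsub'.trans hρs', fun z hz => ?_, fun z hz => ?_⟩
    · refine Metric.ball_subset_ball' ?_ (hρm (hsub hz))
      rw [dist_comm]; linarith
    · refine Metric.ball_subset_ball' ?_ (hρm' (hsub' hz))
      rw [dist_comm]; linarith

/-- Finitely many families of steps, each of them uniformly controlled, are uniformly controlled
together. -/
theorem exists_isControlledStep_of_finite {S : Set (OpenPartialHomeomorph Z Z)} {C : Set Z}
    {R : ℝ} {ι : Type v} {t : Set ι} (ht : t.Finite) (step : ι → Z → Z → Prop)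
    (h : ∀ i ∈ t, ∃ r > 0, ∀ p q, step i p q → ∃ s, IsControlledStep S C r R s p q) :
    ∃ r > 0, ∀ i ∈ t, ∀ p q, step i p q → ∃ s, IsControlledStep S C r R s p q := by
  have h1 : ∀ᶠ r in 𝓝[>] (0 : ℝ), ∀ i ∈ t, ∀ p q, step i p q →
      ∃ s, IsControlledStep S C r R s p q := by
    refine (eventually_all_finite ht).2 fun i hi => ?_
    obtain ⟨r, hr, H⟩ := h i hi
    filter_upwards [Ioc_mem_nhdsGT hr] with r' hr' p q hpq
    exact (H p q hpq).imp fun s hs => hs.mono hr'.2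
  obtain ⟨r, hr, hr0⟩ := (h1.and self_mem_nhdsWithin).exists
  exact ⟨r, hr0, hr⟩

/-- In a strongly equicontinuous setting, a point in the closure of the set of those points that can
be reached from `x` by uniformly controlled steps in a compact set is the image of `x` by a local
homeomorphism which preserves a given invariant closed set. -/
theorem exists_openPartialHomeomorph_of_mem_closure [LocallyCompactSpace Z]
    (M : QuasiLocalMetricCover Z)
    {S : Set (OpenPartialHomeomorph Z Z)} (hsymm : IsSymmetric S)
    (hcomp : IsClosedUnderComposition S)
    (hS : ∀ ε > 0, ∃ δ > 0, ∀ h ∈ S, ∀ (i j : M.ι) (x y : Z), x ∈ h.source → y ∈ h.source →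
      ∀ (hx : x ∈ M.part i) (hy : y ∈ M.part i) (hhx : h x ∈ M.part j) (hhy : h y ∈ M.part j),
        (M.metric i).dist ⟨x, hx⟩ ⟨y, hy⟩ < δ → (M.metric j).dist ⟨h x, hhx⟩ ⟨h y, hhy⟩ < ε)
    {C : Set Z} (hC : IsCompact C) {step : Z → Z → Prop}
    (hstep : ∀ R > 0, ∃ r > 0, ∀ p q, step p q →
      ∃ s, IsControlledStep (insert (OpenPartialHomeomorph.refl Z) S) C r R s p q)
    {K : Set Z} (hK : IsClosed K) (hKS : ∀ h ∈ S, ∀ z ∈ h.source, z ∈ K ↔ h z ∈ K)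
    {x y : Z} (hx : x ∈ C) (hy : y ∈ closure {z | Relation.ReflTransGen step x z}) :
    ∃ e : OpenPartialHomeomorph Z Z, x ∈ e.source ∧ e x = y ∧ ∀ z ∈ e.source, z ∈ K ↔ e z ∈ K := by
  set S' := insert (OpenPartialHomeomorph.refl Z) S with hS'
  have hid : OpenPartialHomeomorph.refl Z ∈ S' := mem_insert _ _
  have hsymm' : IsSymmetric S' := by
    rintro e (rfl | he)
    · simpa using hid
    · exact mem_insert_of_mem _ (hsymm e he)
  have hcomp' : IsClosedUnderComposition S' := by
    rintro e (rfl | he) e' he'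
    · simpa using he'
    · rcases he' with rfl | he'
      · simpa [hS'] using Or.inr he
      · exact mem_insert_of_mem _ (hcomp e he e' he')
  -- `R₁` keeps the balls about `C` inside the compact set `C'`, and `R₂` is the jump threshold on
  -- `C'`; `R` respects both.
  obtain ⟨R₁, hR₁, hC'⟩ := hC.exists_isCompact_cthickening
  set C' := Metric.cthickening R₁ C
  obtain ⟨R₂, hR₂, heq⟩ := exists_isEquicontinuousUpTo M hS hC'
  set R := min R₁ R₂
  have hR : 0 < R := lt_min hR₁ hR₂
  have hball : ∀ p ∈ C, Metric.ball p R ⊆ C' := fun p hp =>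
    (Metric.ball_subset_thickening hp R).trans ((Metric.thickening_mono (min_le_left _ _) C).trans
      (Metric.thickening_subset_cthickening _ _))
  obtain ⟨r', hr', hst'⟩ := hstep R hR
  -- With `2 * r ≤ R`, two points of one `r`-ball are closer than the jump threshold, so
  -- equicontinuity applies to any pair in the domain and not only to pairs containing the center.
  obtain ⟨r, hr, hrR, hst⟩ : ∃ r > 0, 2 * r ≤ R ∧ ∀ p q, step p q →
      ∃ s, IsControlledStep S' C r R s p q := by
    exact ⟨min r' (R / 2), by positivity, by linarith [min_le_right r' (R / 2)],
      fun p q h => (hst' p q h).imp fun s h => h.mono (min_le_left _ _)⟩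
  obtain ⟨δ', hδ', hδe⟩ := heq r hr
  set δ := min δ' r
  have hδ : 0 < δ := lt_min hδ' hr
  have hδr : δ ≤ r := min_le_right _ _
  have hchain : ∀ {p q : Z} {h : OpenPartialHomeomorph Z Z}, p ∈ C → IsChain S' C r R p q h →
      h p = q ∧ ∀ w ∈ Metric.ball p δ, w ∈ h.source ∧ h w ∈ Metric.ball q r := by
    intro p q h hp hpq
    refine hpq.ball_subset hcomp' hid hδ hδr (by linarith) hball ?_ hp
    intro s hs z hz w hw hzs hws hsz hsw hzw hszw
    exact hδe s hs z hz w hw hzs hws hsz hsw (hzw.trans_le (min_le_left _ _))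
      (hszw.trans_le (min_le_right _ _))
  have hrC' : ∀ p ∈ C, Metric.ball p r ⊆ C' := fun p hp =>
    (Metric.ball_subset_ball (by linarith)).trans (hball p hp)
  -- The modulus is uniform in the starting point `p`, so it also serves the inverse chains, which
  -- start at `q`.
  have hequi : ∀ ε > 0, ∃ η > 0, ∀ (p q : Z) (h : OpenPartialHomeomorph Z Z), p ∈ C →
      IsChain S' C r R p q h → ∀ z ∈ Metric.ball p δ, ∀ w ∈ Metric.ball p δ,
      dist z w < η → dist (h z) (h w) < ε := by
    intro ε hε
    obtain ⟨η, hη, H⟩ := heq ε hε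
    refine ⟨η, hη, fun p q h hp hpq z hz w hw hzw => ?_⟩
    have hqC := hpq.right_mem hp
    have hz' := (hchain hp hpq).2 z hz
    have hw' := (hchain hp hpq).2 w hw
    refine H h (hpq.mem hcomp' hid) z (hrC' p hp (Metric.ball_subset_ball hδr hz)) w
      (hrC' p hp (Metric.ball_subset_ball hδr hw)) hz'.1 hw'.1 (hrC' q hqC hz'.2)
      (hrC' q hqC hw'.2) hzw ?_
    have h1 := Metric.mem_ball.1 hz'.2
    have h2 := Metric.mem_ball.1 hw'.2
    have h3 := dist_triangle_right (h z) (h w) q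
    linarith [min_le_right R₁ R₂]
  refine exists_openPartialHomeomorph_limit hC' hδ (F := {h | ∃ q, IsChain S' C r R x q h})
    (closure_mono ?_ hy) ?_ ?_ ?_ ?_ hK ?_
  · intro z hz
    suffices ∃ h, IsChain S' C r R x z h by
      obtain ⟨h, hh⟩ := this
      exact ⟨h, ⟨z, hh⟩, (hchain hx hh).1⟩
    induction hz with
    | refl => exact ⟨_, .refl⟩
    | tail _ hs ih =>
      obtain ⟨h, hh⟩ := ih
      obtain ⟨s, hs⟩ := hst _ _ hs
      exact ⟨_, hh.tail hs⟩
  · rintro h ⟨q, hq⟩ z hz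
    have := (hchain hx hq).2 z hz
    exact ⟨this.1, hrC' q (hq.right_mem hx) this.2⟩
  · rintro h ⟨q, hq⟩ z hz
    rw [(hchain hx hq).1] at hz
    have := (hchain (hq.right_mem hx) (hq.symm hsymm')).2 z hz
    exact ⟨this.1, hrC' x hx this.2⟩
  · intro ε hε
    obtain ⟨η, hη, H⟩ := hequi ε hε
    exact ⟨η, hη, fun h ⟨q, hq⟩ => H x q h hx hq⟩
  · intro ε hε
    obtain ⟨η, hη, H⟩ := hequi ε hε
    refine ⟨η, hη, fun h ⟨q, hq⟩ => ?_⟩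
    rw [(hchain hx hq).1]
    exact H q x h.symm (hq.right_mem hx) (hq.symm hsymm')
  · rintro h ⟨q, hq⟩ z hz
    rcases hq.mem hcomp' hid with rfl | hh
    · rfl
    · exact hKS h hh z hz

end Core

/-! ### Orbit closures. -/

/-- Orbit closures of compactly generated, strongly equicontinuous pseudogroups are homogeneous. -/
theorem isHomogeneous_closure_orbit {Z : Type u} [TopologicalSpace Z] [PolishSpace Z]
    [LocallyCompactSpace Z] (H : StructureGroupoid Z) [ClosedUnderRestriction H]
    (hcg : IsCompactlyGenerated H) (hse : IsStronglyEquicontinuous H) (x : Z) :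
    IsHomogeneous (closure (orbit H x)) := by
  let _ := TopologicalSpace.metrizableSpaceMetric Z
  obtain ⟨U, hUc, hU, E, hEfin, hEsymm, hEgen, hext⟩ := hcg
  obtain ⟨M, S, hsymm, hcomp, hgen, hS⟩ := hse
  obtain ⟨x₀, hx₀, hx₀U⟩ := hU x
  let step : OpenPartialHomeomorph U U → Z → Z → Prop := fun g p q =>
    ∃ z ∈ g.source, (z : Z) = p ∧ (g z : Z) = q
  have hstep : ∀ R > 0, ∃ r > 0, ∀ p q, (∃ g ∈ E, step g p q) → ∃ s,
      IsControlledStep (insert (OpenPartialHomeomorph.refl Z) S) (closure (U : Set Z)) r R s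
        p q := by
    intro R hR
    suffices ∃ r > 0, ∀ g ∈ E, ∀ p q, step g p q → ∃ s,
        IsControlledStep (insert (OpenPartialHomeomorph.refl Z) S) (closure (U : Set Z)) r R s
          p q by
      obtain ⟨r, hr, h⟩ := this
      exact ⟨r, hr, fun p q ⟨g, hg, hpq⟩ => h g hg p q hpq⟩
    refine exists_isControlledStep_of_finite hEfin step fun g hg => ?_
    obtain ⟨h, hH, hgh, heq⟩ := hext g hg
    -- The extension `h` of `g` makes the closure of the domain of `g` a compact family of germs,
    -- whose values stay in the closure of `U` by continuity.
    have hsub : closure (Subtype.val '' g.source) ⊆ closure (U : Set Z) := by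
      refine closure_mono ?_
      rintro _ ⟨z, -, rfl⟩
      exact z.2
    have hmaps : MapsTo h (closure (Subtype.val '' g.source)) (closure (U : Set Z)) := by
      refine MapsTo.closure_of_continuousOn ?_ (h.continuousOn.mono hgh)
      rintro _ ⟨z, hz, rfl⟩
      rw [heq z hz]
      exact (g z).2
    obtain ⟨r, hr, hc⟩ := exists_isControlledStep
      (S := insert (OpenPartialHomeomorph.refl Z) S) (hUc.of_isClosed_subset isClosed_closure hsub)
      continuousOn_id (h.continuousOn.mono hgh) (fun _ hz => hsub hz) hmaps (fun z hz => by
        obtain ⟨s, hs, hzs, hsh⟩ :=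
          exists_eventuallyEq_of_mem_generatedPseudogroup hsymm hcomp (hgen ▸ hH) (hgh hz)
        exact ⟨s, hs, hzs, nhdsWithin_le_nhds (hsh.mono fun w hw => hw.symm)⟩) hR
    refine ⟨r, hr, ?_⟩
    rintro _ _ ⟨z, hz, rfl, rfl⟩
    rw [← heq z hz]
    exact hc z (subset_closure ⟨z, hz, rfl⟩)
  refine isHomogeneous_of_exists (subset_closure hx₀) fun y hy => ?_
  -- The point `y` may lie outside `U`: it is moved into `U` by `k`, and `k.symm` is appended at the
  -- end.
  obtain ⟨y₁, ⟨k, hk, hyk, rfl⟩, hyU⟩ := hU y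
  have hreach : k y ∈ closure {z | Relation.ReflTransGen (fun p q => ∃ g ∈ E, step g p q) x₀ z} := by
    have h1 := mem_closure_iff_frequently.1 (map_mem_closure_orbit hk hyk hy)
    refine mem_closure_iff_frequently.2
      ((h1.and_eventually (U.isOpen.mem_nhds hyU)).mono ?_)
    rintro o ⟨ho, hoU⟩
    obtain ⟨e, he, hxe, heo⟩ := mem_orbit_restrictToOpen (U := U) (x := ⟨x₀, hx₀U⟩) (y := ⟨o, hoU⟩)
      (mem_orbit_trans (mem_orbit_symm hx₀) ho)
    have h2 := reflTransGen_of_mem_generatedPseudogroup hEsymm (hEgen ▸ he) hxe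
    rw [heo] at h2
    refine h2.lift Subtype.val ?_
    rintro p _ ⟨g, hg, hp, rfl⟩
    exact ⟨g, hg, p, hp, rfl, rfl⟩
  obtain ⟨e, hxe, hey, heK⟩ := exists_openPartialHomeomorph_of_mem_closure M hsymm hcomp hS hUc
    hstep (K := closure (orbit H x)) isClosed_closure
    (fun h hh z hz => map_mem_closure_orbit_iff (hgen ▸ mem_generatedPseudogroup hh) hz)
    (subset_closure hx₀U) hreach
  refine ⟨e.trans k.symm, ?_, ?_, fun z hz => ?_⟩
  · rw [OpenPartialHomeomorph.trans_source]
    exact ⟨hxe, by rw [mem_preimage, hey]; exact k.map_source hyk⟩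
  · rw [OpenPartialHomeomorph.coe_trans, Function.comp_apply, hey, k.left_inv hyk]
  · rw [OpenPartialHomeomorph.trans_source] at hz
    exact (heK z hz.1).trans (map_mem_closure_orbit_iff (H.symm hk) hz.2)

/-! ### Flow boxes, transverse models and holonomy. -/

/-- The inclusion of a summand of a disjoint union, as a local homeomorphism. -/
noncomputable def sigmaMkHomeomorph {ι : Type*} {T : ι → Type*} [∀ i, TopologicalSpace (T i)]
    (i : ι) (h : Nonempty (T i)) : OpenPartialHomeomorph (T i) (Σ i, T i) :=
  (IsOpenEmbedding.sigmaMk (σ := T) (i := i)).toOpenPartialHomeomorph _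

section

variable {ι : Type*} {T : ι → Type*} [∀ i, TopologicalSpace (T i)] {i : ι} (h : Nonempty (T i))

@[simp] theorem sigmaMkHomeomorph_apply (t : T i) : sigmaMkHomeomorph i h t = ⟨i, t⟩ := rfl

@[simp] theorem sigmaMkHomeomorph_source : (sigmaMkHomeomorph i h).source = univ := rfl

@[simp] theorem sigmaMkHomeomorph_target :
    (sigmaMkHomeomorph i h).target = range (Sigma.mk i) := by
  simp [sigmaMkHomeomorph]

@[simp] theorem sigmaMkHomeomorph_symm_apply (t : T i) :
    (sigmaMkHomeomorph i h).symm ⟨i, t⟩ = t :=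
  (sigmaMkHomeomorph i h).left_inv (mem_univ t)

end

namespace FoliatedAtlas

variable {n : ℕ} {X : Type u} [TopologicalSpace X] (F : FoliatedAtlas n X)

theorem continuousOn_proj (i : F.ι) : ContinuousOn (F.proj i) (F.chart i).source :=
  continuous_snd.comp_continuousOn (F.chart i).continuousOn

theorem isOpen_image_proj (i : F.ι) {W : Set X} (hW : IsOpen W) (hWs : W ⊆ (F.chart i).source) :
    IsOpen (F.proj i '' W) := by
  have := isOpenMap_snd _ ((F.chart i).isOpen_image_of_subset_source hW hWs)
  rwa [image_image] at this

theorem mem_target {i : F.ι} {b : EuclideanSpace ℝ (Fin n)}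
    (hb : b ∈ Metric.ball (F.center i) (F.radius i)) (t : F.T i) :
    (b, t) ∈ (F.chart i).target := by
  rw [F.target_chart]
  exact ⟨hb, mem_univ t⟩

theorem proj_symm {i : F.ι} {p : EuclideanSpace ℝ (Fin n) × F.T i}
    (hp : p ∈ (F.chart i).target) : F.proj i ((F.chart i).symm p) = p.2 := by
  rw [proj, (F.chart i).right_inv hp]

theorem chart_fst_mem {i : F.ι} {x : X} (hx : x ∈ (F.chart i).source) :
    (F.chart i x).1 ∈ Metric.ball (F.center i) (F.radius i) := by
  have := (F.chart i).map_source hx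
  rw [F.target_chart] at this
  exact this.1

theorem symm_fst_proj {i : F.ι} {x : X} (hx : x ∈ (F.chart i).source) :
    (F.chart i).symm ((F.chart i x).1, F.proj i x) = x :=
  (F.chart i).left_inv hx

/-- The transverse models are only assumed Polish; they inherit local compactness from `X`, since
`F.proj i` is continuous and open. -/
theorem exists_isCompact_mem_nhds [LocallyCompactSpace X] (p : Σ i, F.T i) :
    ∃ C, IsCompact C ∧ C ∈ 𝓝 p := by
  obtain ⟨i, t⟩ := p
  have ht := F.mem_target (Metric.mem_ball_self (F.radius_pos i)) t
  obtain ⟨N, hN, hNs, hNc⟩ := local_compact_nhds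
    ((F.chart i).open_source.mem_nhds ((F.chart i).map_target ht))
  refine ⟨Sigma.mk i '' (F.proj i '' N),
    (hNc.image_of_continuousOn ((F.continuousOn_proj i).mono hNs)).image continuous_sigmaMk, ?_⟩
  refine IsOpenEmbedding.sigmaMk.isOpenMap.image_mem_nhds (mem_of_superset
    ((F.isOpen_image_proj i isOpen_interior (interior_subset.trans hNs)).mem_nhds ?_)
    (image_mono interior_subset))
  exact ⟨_, mem_interior_iff_mem_nhds.2 hN, F.proj_symm ht⟩

/-- Near each point of the overlap of two flow boxes, the holonomy pseudogroup contains a coordinate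
change of the transverse coordinates. -/
theorem exists_mem_holonomyPseudogroup {i j : F.ι} {x : X} (hxi : x ∈ (F.chart i).source)
    (hxj : x ∈ (F.chart j).source) :
    ∃ h ∈ F.holonomyPseudogroup, (⟨i, F.proj i x⟩ : Σ i, F.T i) ∈ h.source ∧
      ∀ᶠ y in 𝓝 x, h ⟨i, F.proj i y⟩ = ⟨j, F.proj j y⟩ := by
  obtain ⟨W, hW, hxW, hWs, t, ht, htW⟩ := F.plaquePreserving i j x ⟨hxi, hxj⟩
  obtain ⟨W', hW', hxW', hWs', t', ht', htW'⟩ := F.plaquePreserving j i x ⟨hxj, hxi⟩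
  -- The transverse maps `t` and `t'` come from the two directions of the coordinate change; over `W
  -- ∩ W'` they are mutually inverse.
  have hV : IsOpen (W ∩ W') := hW.inter hW'
  have htV : ∀ y ∈ W ∩ W', t (F.proj i y) = F.proj j y := fun y hy => (htW y hy.1).symm
  have htV' : ∀ y ∈ W ∩ W', t' (F.proj j y) = F.proj i y := fun y hy => (htW' y hy.2).symm
  let k : OpenPartialHomeomorph (F.T i) (F.T j) :=
    { toFun := t
      invFun := t'
      source := F.proj i '' (W ∩ W')
      target := F.proj j '' (W ∩ W')
      map_source' := by
        rintro _ ⟨y, hy, rfl⟩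
        exact ⟨y, hy, (htV y hy).symm⟩
      map_target' := by
        rintro _ ⟨y, hy, rfl⟩
        exact ⟨y, hy, (htV' y hy).symm⟩
      left_inv' := by
        rintro _ ⟨y, hy, rfl⟩
        rw [htV y hy, htV' y hy]
      right_inv' := by
        rintro _ ⟨y, hy, rfl⟩
        rw [htV' y hy, htV y hy]
      open_source := F.isOpen_image_proj i hV fun y hy => (hWs hy.1).1
      open_target := F.isOpen_image_proj j hV fun y hy => (hWs hy.1).2
      continuousOn_toFun := ht.mono (image_mono inter_subset_left)
      continuousOn_invFun := ht'.mono (image_mono inter_subset_right) }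
  let h := (sigmaMkHomeomorph i ⟨F.proj i x⟩).symm.trans (k.trans (sigmaMkHomeomorph j ⟨F.proj j x⟩))
  have hsource : h.source = Sigma.mk i '' (F.proj i '' (W ∩ W')) := by
    ext p
    simp only [h, OpenPartialHomeomorph.trans_source, OpenPartialHomeomorph.symm_source,
      sigmaMkHomeomorph_target, sigmaMkHomeomorph_source, preimage_univ, inter_univ, mem_inter_iff,
      mem_range, mem_preimage]
    constructor
    · rintro ⟨⟨s, rfl⟩, hs⟩
      rw [sigmaMkHomeomorph_symm_apply] at hs
      exact ⟨s, hs, rfl⟩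
    · rintro ⟨s, hs, rfl⟩
      rw [sigmaMkHomeomorph_symm_apply]
      exact ⟨⟨s, rfl⟩, hs⟩
  have happly : ∀ y ∈ W ∩ W', h ⟨i, F.proj i y⟩ = ⟨j, F.proj j y⟩ := by
    intro y hy
    change sigmaMkHomeomorph j ⟨F.proj j x⟩
      (t ((sigmaMkHomeomorph i ⟨F.proj i x⟩).symm ⟨i, F.proj i y⟩)) = _
    rw [sigmaMkHomeomorph_symm_apply, htV y hy, sigmaMkHomeomorph_apply]
  refine ⟨h, mem_generatedPseudogroup ⟨i, j, W ∩ W', hV, fun y hy => hWs hy.1, hsource, happly⟩, ?_,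
    mem_of_superset (hV.mem_nhds ⟨hxW, hxW'⟩) happly⟩
  rw [hsource]
  exact ⟨_, ⟨x, ⟨hxW, hxW'⟩, rfl⟩, rfl⟩

/-! ### Saturated sets and their traces on the transverse models. -/

section Saturated

/-- A set is saturated if it is a union of plaques in every flow box. -/
def IsSaturated (K : Set X) : Prop :=
  ∀ i, ∀ z ∈ (F.chart i).source, ∀ w ∈ (F.chart i).source, F.proj i z = F.proj i w → z ∈ K → w ∈ K

/-- The set of the plaques that lie in `K`. -/
def trace (K : Set X) : Set (Σ i, F.T i) :=
  {p | ∃ z ∈ (F.chart p.1).source, F.proj p.1 z = p.2 ∧ z ∈ K}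

variable {F} {K : Set X}

theorem IsSaturated.mem_trace_iff (hK : F.IsSaturated K) {i : F.ι} {z : X}
    (hz : z ∈ (F.chart i).source) : (⟨i, F.proj i z⟩ : Σ i, F.T i) ∈ F.trace K ↔ z ∈ K := by
  refine ⟨?_, fun h => ⟨z, hz, rfl, h⟩⟩
  rintro ⟨w, hw, hwz, hwK⟩
  exact hK i w hw z hz hwz hwK

/-- In each model the trace is the preimage of `K` under the continuous section through the center
of the ball. -/
theorem IsSaturated.isClosed_trace (hK : F.IsSaturated K) (hKc : IsClosed K) :
    IsClosed (F.trace K) := by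
  refine isClosed_sigma_iff.2 fun i => ?_
  have hmem := fun t : F.T i => F.mem_target (Metric.mem_ball_self (F.radius_pos i)) t
  have hcont : Continuous fun t : F.T i => (F.chart i).symm (F.center i, t) :=
    (F.chart i).symm.continuousOn.comp_continuous (by fun_prop) hmem
  convert hKc.preimage hcont using 1
  ext t
  rw [mem_preimage, mem_preimage, ← hK.mem_trace_iff ((F.chart i).map_target (hmem t)),
    F.proj_symm (hmem t)]

theorem IsSaturated.mem_trace_iff_of_mem_holonomyPseudogroup (hK : F.IsSaturated K)
    {h : OpenPartialHomeomorph (Σ i, F.T i) (Σ i, F.T i)} (hh : h ∈ F.holonomyPseudogroup)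
    {p : Σ i, F.T i} (hp : p ∈ h.source) : p ∈ F.trace K ↔ h p ∈ F.trace K := by
  have hgen : ∀ e : OpenPartialHomeomorph (Σ i, F.T i) (Σ i, F.T i),
      (∃ (i j : F.ι) (W : Set X), IsOpen W ∧ W ⊆ (F.chart i).source ∩ (F.chart j).source ∧
        e.source = Sigma.mk i '' (F.proj i '' W) ∧
        ∀ x ∈ W, e ⟨i, F.proj i x⟩ = ⟨j, F.proj j x⟩) →
      ∀ p ∈ e.source, p ∈ F.trace K ↔ e p ∈ F.trace K := by
    rintro e ⟨i, j, W, -, hWs, hsource, he⟩ p hp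
    rw [hsource] at hp
    obtain ⟨_, ⟨z, hz, rfl⟩, rfl⟩ := hp
    rw [he z hz, hK.mem_trace_iff (hWs hz).1, hK.mem_trace_iff (hWs hz).2]
  refine generatedPseudogroup_induction (fun f p => p ∈ F.trace K ↔ f p ∈ F.trace K)
    (fun _ => Iff.rfl) (fun f g p hf hg => hf.trans hg)
    (fun f g p hfg hf => hfg.eq_of_nhds ▸ hf) hgen (fun e he p hp => ?_) hh p hp
  rw [hgen e he _ (e.map_target hp), e.right_inv hp]

/-- Points of `K` near `z`, slid along their plaques to the ball coordinate of `w`, are points of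
`K` near `w`. -/
theorem IsSaturated.closure (hK : F.IsSaturated K) : F.IsSaturated (closure K) := by
  intro i z hz w hw hzw hzK
  have hmem : ∀ y, ((F.chart i w).1, F.proj i y) ∈ (F.chart i).target := fun y =>
    F.mem_target (F.chart_fst_mem hw) _
  have hcont : ContinuousAt (fun y => (F.chart i).symm ((F.chart i w).1, F.proj i y)) z :=
    ContinuousAt.comp (f := fun y => ((F.chart i w).1, F.proj i y))
      ((F.chart i).symm.continuousAt (hmem z)) (continuousAt_const.prodMk
        ((F.continuousOn_proj i).continuousAt ((F.chart i).open_source.mem_nhds hz)))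
  have hval : (F.chart i).symm ((F.chart i w).1, F.proj i z) = w := by
    rw [hzw, F.symm_fst_proj hw]
  rw [mem_closure_iff_frequently] at hzK ⊢
  have := hcont.tendsto
  simp only [hval] at this
  refine this.frequently ((hzK.and_eventually ((F.chart i).open_source.mem_nhds hz)).mono ?_)
  rintro y ⟨hyK, hy⟩
  exact hK i y hy _ ((F.chart i).map_target (hmem y)) (F.proj_symm (hmem y)).symm hyK

end Saturated

/-! ### Leaves and compatible atlases. -/

section Leaves

variable {F} {F' : FoliatedAtlas n X}

/-- Open subsets of the plaques of a compatible atlas are open in the leaf topology. -/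
theorem Compatible.isOpen_plaque (hF : F.Compatible F') {V : Set X} (hV : IsOpen V) (i : F'.ι)
    (t : F'.T i) : IsOpen[F.leafTopology] (V ∩ {y | y ∈ (F'.chart i).source ∧ F'.proj i y = t}) := by
  rw [@isOpen_iff_forall_mem_open _ F.leafTopology]
  rintro w ⟨hwV, hws, hwt⟩
  obtain ⟨j, hj⟩ := F.cover w
  obtain ⟨W, hW, hwW, hWs, τ, -, hτ⟩ := (hF j i).1 w ⟨hj, hws⟩
  have hD := ((F.chart j).isOpen_inter_preimage_symm (hV.inter hW)).preimage
    (Continuous.prodMk_left (F.proj j w))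
  refine ⟨(F.chart j).source ∩ F.chart j ⁻¹' (((fun b => (b, F.proj j w)) ⁻¹'
    ((F.chart j).target ∩ (F.chart j).symm ⁻¹' (V ∩ W))) ×ˢ {F.proj j w}), ?_,
    isOpen_generateFrom_of_mem ⟨j, _, _, hD, rfl⟩, hj, ⟨?_, ?_⟩, rfl⟩
  · rintro y ⟨hyj, ⟨-, hy⟩, hyw⟩
    rw [mem_singleton_iff] at hyw
    rw [← hyw] at hy
    change (F.chart j).symm (F.chart j y) ∈ V ∩ W at hy
    rw [(F.chart j).left_inv hyj] at hy
    refine ⟨hy.1, (hWs hy.2).2, ?_⟩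
    rw [← hwt]
    change (F'.chart i y).2 = (F'.chart i w).2
    rw [hτ y hy.2, hτ w hwW, hyw]
    rfl
  · exact (F.chart j).map_source hj
  · change (F.chart j).symm (F.chart j w) ∈ V ∩ W
    rw [(F.chart j).left_inv hj]
    exact ⟨hwV, hwW⟩

/-- Leaves are saturated with respect to every compatible atlas. -/
theorem Compatible.isSaturated_leaf (hF : F.Compatible F') (x : X) :
    F'.IsSaturated (F.leaf x) := by
  intro i z hz w hw hzw hzx
  -- This parametrizes the plaque of `z` by a ball. It is continuous into the leaf topology because
  -- transverse coordinates of `F` are locally constant along it, so the plaque is connected there.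
  let f : EuclideanSpace ℝ (Fin n) → X := fun b => (F'.chart i).symm (b, F'.proj i z)
  have hfX : ContinuousOn f (Metric.ball (F'.center i) (F'.radius i)) :=
    (F'.chart i).symm.continuousOn.comp (by fun_prop) fun b hb => F'.mem_target hb _
  have hf : @ContinuousOn _ _ _ F.leafTopology f (Metric.ball (F'.center i) (F'.radius i)) := by
    refine continuousOn_to_generateFrom_iff.2 ?_
    rintro b hb _ ⟨j, t, D, hD, rfl⟩ ⟨hbj, hbD, hbt⟩
    obtain ⟨W, hW, hbW, hWs, τ, -, hτ⟩ :=
      (hF j i).2 (f b) ⟨(F'.chart i).map_target (F'.mem_target hb _), hbj⟩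
    have h1 : ContinuousWithinAt (fun b => (F.chart j (f b)).1)
        (Metric.ball (F'.center i) (F'.radius i)) b :=
      (continuous_fst.continuousAt.comp ((F.chart j).continuousAt hbj)).comp_continuousWithinAt
        (hfX b hb)
    filter_upwards [h1 (hD.mem_nhds hbD), hfX b hb (hW.mem_nhds hbW), self_mem_nhdsWithin]
      with b' hb'D hb'W hb'
    refine ⟨(hWs hb'W).2, hb'D, ?_⟩
    rw [mem_singleton_iff] at hbt ⊢
    rw [← hbt, hτ _ hb'W, hτ _ hbW]
    change τ (F'.proj i (f b')) = τ (F'.proj i (f b))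
    rw [F'.proj_symm (F'.mem_target hb' _), F'.proj_symm (F'.mem_target hb _)]
  have hpre := @IsPreconnected.image _ _ _ F.leafTopology _
    (convex_ball (F'.center i) (F'.radius i)).isPreconnected f hf
  have hz' : z ∈ f '' Metric.ball (F'.center i) (F'.radius i) :=
    ⟨_, F'.chart_fst_mem hz, F'.symm_fst_proj hz⟩
  have hw' : w ∈ f '' Metric.ball (F'.center i) (F'.radius i) :=
    ⟨_, F'.chart_fst_mem hw, by simp only [f]; rw [hzw, F'.symm_fst_proj hw]⟩
  have h2 := @IsPreconnected.subset_connectedComponent _ F.leafTopology _ _ hpre hz' _ hw'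
  rw [leaf] at hzx ⊢
  rwa [@connectedComponent_eq _ F.leafTopology _ _ hzx]

end Leaves

/-! ### Leaf closures. -/

/-- A local homeomorphism between transverse models which moves the plaque of `x` to the plaque of
`y` and preserves the trace of a saturated set is induced by a local homeomorphism which moves `x`
to `y` and preserves the saturated set. -/
theorem IsSaturated.exists_openPartialHomeomorph {F : FoliatedAtlas n X} {K : Set X}
    (hK : F.IsSaturated K) {i j : F.ι} {x y : X} (hx : x ∈ (F.chart i).source)
    (hy : y ∈ (F.chart j).source) {e : OpenPartialHomeomorph (Σ i, F.T i) (Σ i, F.T i)}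
    (hxe : (⟨i, F.proj i x⟩ : Σ i, F.T i) ∈ e.source)
    (hey : e ⟨i, F.proj i x⟩ = ⟨j, F.proj j y⟩)
    (heK : ∀ p ∈ e.source, p ∈ F.trace K ↔ e p ∈ F.trace K) :
    ∃ e' : OpenPartialHomeomorph X X, x ∈ e'.source ∧ e' x = y ∧
      ∀ z ∈ e'.source, z ∈ K ↔ e' z ∈ K := by
  let mi := sigmaMkHomeomorph (T := F.T) i ⟨F.proj i x⟩
  let mj := sigmaMkHomeomorph (T := F.T) j ⟨F.proj j y⟩
  -- Any map of the ball factor carrying the coordinate of `x` to that of `y` would do, since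
  -- membership in `K` depends only on the plaque.
  let a := (Homeomorph.addRight ((F.chart j y).1 - (F.chart i x).1)).toOpenPartialHomeomorph
  let k := a.prod ((mi.trans e).trans mj.symm)
  have hk : k (F.chart i x) = F.chart j y := by
    refine Prod.ext ?_ ?_
    · change (F.chart i x).1 + ((F.chart j y).1 - (F.chart i x).1) = _
      abel
    · change mj.symm (e ⟨i, F.proj i x⟩) = F.proj j y
      rw [hey]
      exact sigmaMkHomeomorph_symm_apply _ _
  refine ⟨((F.chart i).trans k).trans (F.chart j).symm, ?_, ?_, ?_⟩
  · rw [OpenPartialHomeomorph.trans_source, OpenPartialHomeomorph.trans_source]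
    refine ⟨⟨hx, ⟨mem_univ _, ⟨⟨mem_univ _, hxe⟩, ?_⟩⟩⟩, ?_⟩
    · change e ⟨i, F.proj i x⟩ ∈ mj.target
      rw [hey, sigmaMkHomeomorph_target]
      exact mem_range_self _
    · change k (F.chart i x) ∈ (F.chart j).target
      rw [hk]
      exact (F.chart j).map_source hy
  · change (F.chart j).symm (k (F.chart i x)) = y
    rw [hk, (F.chart j).left_inv hy]
  · rintro z ⟨⟨hz, ⟨-, ⟨⟨-, hze⟩, hzj⟩⟩⟩, hzk⟩
    change k (F.chart i z) ∈ (F.chart j).target at hzk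
    change (⟨i, F.proj i z⟩ : Σ i, F.T i) ∈ e.source at hze
    change e ⟨i, F.proj i z⟩ ∈ mj.target at hzj
    change z ∈ K ↔ (F.chart j).symm (k (F.chart i z)) ∈ K
    rw [← hK.mem_trace_iff hz, heK _ hze, ← hK.mem_trace_iff ((F.chart j).map_target hzk),
      F.proj_symm hzk]
    have : (⟨j, (k (F.chart i z)).2⟩ : Σ i, F.T i) = e ⟨i, F.proj i z⟩ := mj.right_inv hzj
    rw [this]

/-- Closures of leaves of compact strongly equicontinuous foliated spaces are homogeneous. -/
theorem isHomogeneous_closure_leaf [T2Space X] [CompactSpace X] (F : FoliatedAtlas n X)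
    (hF : F.StronglyEquicontinuous) (x : X) : IsHomogeneous (closure (F.leaf x)) := by
  obtain ⟨F', hFF', M, S, hsymm, hcomp, hgen, hS⟩ := hF
  let _ := TopologicalSpace.metrizableSpaceMetric (Σ i, F'.T i)
  have : WeaklyLocallyCompactSpace (Σ i, F'.T i) := ⟨F'.exists_isCompact_mem_nhds⟩
  choose c hc using F'.cover
  choose N hN hNs hNc using fun z =>
    local_compact_nhds ((F'.chart (c z)).open_source.mem_nhds (hc z))
  obtain ⟨A, -, hA⟩ := isCompact_univ.elim_nhds_subcover (fun z => interior (N z))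
    fun z (_ : z ∈ univ) => interior_mem_nhds.2 (hN z)
  have hcov : ∀ z, ∃ a ∈ A, z ∈ interior (N a) := fun z => by simpa using hA (mem_univ z)
  let τ : X → X → Σ i, F'.T i := fun a z => ⟨c a, F'.proj (c a) z⟩
  have hτ : ∀ a, ContinuousOn (τ a) (N a) := fun a =>
    continuous_sigmaMk.comp_continuousOn ((F'.continuousOn_proj _).mono (hNs a))
  let C := ⋃ a ∈ A, τ a '' N a
  have hC : IsCompact C :=
    A.isCompact_biUnion fun a _ => (hNc a).image_of_continuousOn (hτ a)
  have hmC : ∀ a ∈ A, ∀ z ∈ N a, τ a z ∈ C := fun a ha z hz =>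
    mem_biUnion (x := a) (Finset.mem_coe.2 ha) (mem_image_of_mem _ hz)
  -- A step rereads one point of `X` in another flow box. The compact set `N a ∩ N b` parametrizes
  -- the germs, which makes the control uniform.
  let step' : X × X → (Σ i, F'.T i) → (Σ i, F'.T i) → Prop := fun ab p q =>
    ∃ z ∈ N ab.1 ∩ N ab.2, τ ab.1 z = p ∧ τ ab.2 z = q
  let step : (Σ i, F'.T i) → (Σ i, F'.T i) → Prop := fun p q =>
    ∃ ab ∈ (A ×ˢ A : Finset (X × X)), step' ab p q
  have hstep : ∀ R > 0, ∃ r > 0, ∀ p q, step p q → ∃ s,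
      IsControlledStep (insert (OpenPartialHomeomorph.refl _) S) C r R s p q := by
    intro R hR
    obtain ⟨r, hr, h⟩ : ∃ r > 0, ∀ ab ∈ ((A ×ˢ A : Finset (X × X)) : Set (X × X)),
        ∀ p q, step' ab p q → ∃ s,
        IsControlledStep (insert (OpenPartialHomeomorph.refl _) S) C r R s p q := by
      refine exists_isControlledStep_of_finite (Finset.finite_toSet _) step' ?_
      rintro ⟨a, b⟩ hab
      obtain ⟨ha, hb⟩ := Finset.mem_product.1 (Finset.mem_coe.1 hab)
      obtain ⟨r, hr, H⟩ := exists_isControlledStep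
        (S := insert (OpenPartialHomeomorph.refl _) S) ((hNc a).inter (hNc b))
        ((hτ a).mono inter_subset_left) ((hτ b).mono inter_subset_right)
        (fun z hz => hmC a ha z hz.1) (fun z hz => hmC b hb z hz.2) (fun z hz => by
          obtain ⟨h, hh, hzh, hhz⟩ :=
            F'.exists_mem_holonomyPseudogroup (hNs a hz.1) (hNs b hz.2)
          obtain ⟨s, hs, hzs, hsh⟩ :=
            exists_eventuallyEq_of_mem_generatedPseudogroup hsymm hcomp (hgen ▸ hh) hzh
          refine ⟨s, hs, hzs, ?_⟩
          filter_upwards [((hτ a).mono inter_subset_left z hz).eventually hsh,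
            nhdsWithin_le_nhds hhz] with w hw hw'
          rw [← hw, hw']) hR
      refine ⟨r, hr, ?_⟩
      rintro _ _ ⟨z, hz, rfl, rfl⟩
      exact H z hz
    exact ⟨r, hr, fun p q ⟨ab, hab, hpq⟩ => h ab hab p q hpq⟩
  have hreach : ∀ z ∈ F.leaf x, ∀ a ∈ A, x ∈ N a → ∀ b ∈ A, z ∈ N b →
      Relation.ReflTransGen step (τ a x) (τ b z) := by
    have hsing : ∀ a ∈ A, ∀ b ∈ A, ∀ z ∈ N a, z ∈ N b → step (τ a z) (τ b z) :=
      fun a ha b hb z hza hzb => ⟨(a, b), Finset.mk_mem_product ha hb, z, ⟨hza, hzb⟩, rfl, rfl⟩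
    -- A small leafwise neighborhood lies in one plaque of a box `d`, so any two of its points are
    -- linked through the same transverse point of `d`; connectedness of the leaf then links all of
    -- it.
    have hplaque : ∀ z, ∃ V, IsOpen[F.leafTopology] V ∧ z ∈ V ∧ ∀ w ∈ V, ∀ w' ∈ V,
        ∀ a ∈ A, w ∈ N a → ∀ b ∈ A, w' ∈ N b → Relation.ReflTransGen step (τ a w) (τ b w') := by
      intro z
      obtain ⟨d, hd, hzd⟩ := hcov z
      refine ⟨_, hFF'.isOpen_plaque isOpen_interior (c d) (F'.proj (c d) z),
        ⟨hzd, hNs d (interior_subset hzd), rfl⟩, ?_⟩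
      rintro w ⟨hw, -, hwz⟩ w' ⟨hw', -, hwz'⟩ a ha hwa b hb hwb
      have h1 := hsing a ha d hd w hwa (interior_subset hw)
      have h2 := hsing d hd b hb w' (interior_subset hw') hwb
      have h3 : τ d w = τ d w' := by simp only [τ]; rw [hwz, hwz']
      rw [h3] at h1
      exact .tail (.single h1) h2
    have hpre := @isPreconnected_connectedComponent _ F.leafTopology x
    intro z hz
    refine @IsPreconnected.induction₂ _ F.leafTopology _ hpre (fun w w' =>
      ∀ a ∈ A, w ∈ N a → ∀ b ∈ A, w' ∈ N b → Relation.ReflTransGen step (τ a w) (τ b w')) ?_ ?_ ?_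
      x z (@mem_connectedComponent _ F.leafTopology x) hz
    · intro w _
      obtain ⟨V, hV, hwV, h⟩ := hplaque w
      exact mem_of_superset (@nhdsWithin_le_nhds _ F.leafTopology _ _ _
        (@IsOpen.mem_nhds _ F.leafTopology _ _ hV hwV)) fun w' hw' => h w hwV w' hw'
    · intro w₁ w₂ w₃ _ _ _ h₁ h₂ a ha hwa b hb hwb
      obtain ⟨d, hd, hwd⟩ := hcov w₂
      exact (h₁ a ha hwa d hd (interior_subset hwd)).trans (h₂ d hd (interior_subset hwd) b hb hwb)
    -- Chains can be reversed because exchanging the two boxes reverses a step.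
    · intro w₁ w₂ _ _ h a ha hwa b hb hwb
      refine Relation.ReflTransGen.mono ?_ _ _ ((h b hb hwb a ha hwa).swap _ _)
      rintro _ _ ⟨⟨a, b⟩, hab, w, hw, rfl, rfl⟩
      obtain ⟨ha, hb⟩ := Finset.mem_product.1 hab
      exact hsing b hb a ha w hw.2 hw.1
  have hsat : F'.IsSaturated (closure (F.leaf x)) := (hFF'.isSaturated_leaf x).closure
  refine isHomogeneous_of_exists
    (subset_closure (@mem_connectedComponent _ F.leafTopology x)) fun y hy => ?_
  obtain ⟨a, ha, hxa⟩ := hcov x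
  obtain ⟨b, hb, hyb⟩ := hcov y
  have hyc : τ b y ∈ closure {p | Relation.ReflTransGen step (τ a x) p} := by
    rw [mem_closure_iff_frequently] at hy ⊢
    refine ((hτ b).continuousAt (mem_interior_iff_mem_nhds.1 hyb)).tendsto.frequently
      ((hy.and_eventually (mem_interior_iff_mem_nhds.1 hyb)).mono ?_)
    rintro z ⟨hz, hzb⟩
    exact hreach z hz a ha (interior_subset hxa) b hb hzb
  obtain ⟨e, hxe, hey, heK⟩ := exists_openPartialHomeomorph_of_mem_closure M hsymm hcomp hS hC
    hstep (hsat.isClosed_trace isClosed_closure)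
    (fun h hh p hp =>
      hsat.mem_trace_iff_of_mem_holonomyPseudogroup (hgen ▸ mem_generatedPseudogroup hh) hp)
    (hmC a ha x (interior_subset hxa)) hyc
  exact hsat.exists_openPartialHomeomorph (hNs a (interior_subset hxa)) (hNs b (interior_subset hyb))
    hxe hey heK

end FoliatedAtlas

end LocalTransformations

theorem corollaryc :
    (∀ (Z : Type u) [TopologicalSpace Z] [PolishSpace Z] [LocallyCompactSpace Z]
      (H : StructureGroupoid Z) [ClosedUnderRestriction H],
      LocalTransformations.IsQuasiEffective H →
      LocalTransformations.IsCompactlyGenerated H →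
      LocalTransformations.IsStronglyEquicontinuous H →
      ∀ x : Z, LocalTransformations.IsHomogeneous (closure (LocalTransformations.orbit H x))) ∧
    (∀ (n : ℕ) (X : Type v) [TopologicalSpace X] [PolishSpace X] [CompactSpace X]
      (F : LocalTransformations.FoliatedAtlas n X),
      F.StronglyEquicontinuous → F.QuasiEffective →
      ∀ x : X, LocalTransformations.IsHomogeneous (closure (F.leaf x))) := by
  refine ⟨?_, ?_⟩
  · intro Z _ _ _ H _ _ hcg hse x
    exact LocalTransformations.isHomogeneous_closure_orbit H hcg hse x
  · intro n X _ _ _ F hse _ x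
    exact F.isHomogeneous_closure_leaf hse x
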